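/- There are absolute constants $C_1,C_2>0$ such that for every $C_3$ there is a constant $C>0$ with the following property. Let $1\le d<n$, let $A\in\mathbb{R}^{n\times d}$ have rank $d$, let $A=U\Sigma V^T$ be a thin singular value decomposition, and let $c_{ij}=\langle U_{(i)},U_{(j)}\rangle$ and $\ell_i=\|U_{(i)}\|_2^2$ be the cross-leverage and leverage scores, where $U_{(i)}$ is the $i$-th row of $U$. Let $\varepsilon\in(0,1/2]$ and $\kappa>1$, and let $r_1,r_2$ be integers with $r_1\ge C_1\frac{d\ln n}{\varepsilon^2}\ln\frac{d\ln n}{\varepsilon^2}$ and $C_2\,\varepsilon^{-2}\ln n\le r_2\le C_3\,\varepsilon^{-2}\ln n$. Consider the following randomized algorithm. 1. (Sketch.) Let $N$ be the least power of two with $N\ge n$. Let $\Pi_1\in\mathbb{R}^{r_1\times n}$ be the subsampled randomized Hadamard transform: pad vectors of $\mathbb{R}^n$ by zeros to length $N$, multiply the coordinates by independent uniform random signs, apply the normalized $N\times N$ Hadamard matrix, keep $r_1$ coordinates drawn independently and uniformly with replacement, and multiply by $\sqrt{N/r_1}$. Compute from $\Pi_1A$ a matrix $R^{-1}\in\mathbb{R}^{d\times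 d}$ by a fixed rule such that, whenever $\Pi_1A$ has rank $d$, the columns of $\Pi_1AR^{-1}$ are orthonormal (for example $R^{-1}=V'\Sigma'^{-1}$ for a thin singular value decomposition $\Pi_1A=U'\Sigma'V'^T$, or $R$ from a QR factorization). Let $\Pi_2\in\mathbb{R}^{d\times r_2}$ have independent entries, independent of $\Pi_1$, equal to $\sqrt{3/r_2}$ and to $-\sqrt{3/r_2}$ with probability $1/6$ each and to $0$ otherwise. Put $\Omega=AR^{-1}\Pi_2$, with rows $\Omega_{(1)},\dots,\Omega_{(n)}$. 2. (Heavy pairs.) Sort the rows of $\Omega$ by norm. With two pointers into the sorted list, run through the unordered pairs $\{i,j\}$ ($i=j$ allowed) with $\|\Omega_{(i)}\|_2^2\|\Omega_{(j)}\|_2^2\ge d/\kappa$, compute $\tilde c_{ij}=\langle\Omega_{(i)},\Omega_{(j)}\rangle$ for each of them, and return the pair together with $\tilde c_{ij}$ if $\tilde c_{ij}^2\ge d/\kappa$. Then, with probability at least $0.8$, all of the following hold: (i) every pair $(i,j)$ with $c_{ij}^2\ge \frac d\kappa+12\varepsilon\ell_i\ell_j$ is returned, and every returned pair satisfies $c_{ij}^2\ge\frac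 d\kappa-30\varepsilon\ell_i\ell_j$; (ii) for every returned pair, $\tilde c_{ij}^2-30\varepsilon\ell_i\ell_j\le c_{ij}^2\le\tilde c_{ij}^2+12\varepsilon\ell_i\ell_j$; (iii) the running time of step 2, that is, the number of elementary operations (arithmetic operations on reals and indices, comparisons, array accesses and elementary list operations) that the algorithm makes once $\Omega$ has been computed, is at most $C\left(\varepsilon^{-2}n\ln n+\varepsilon^{-3}\kappa d\ln^2 n\right)$. -/

import Mathlib

open scoped ENNReal

namespace CrossLev

noncomputable section

/-! ## Singular vectors, leverage scores, orthogonalizers -/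

/-- `A = U Σ Vᵀ` is a thin singular value decomposition of a matrix with `d` columns and rank `d`:
`U` and `V` have orthonormal columns and the `d` singular values `σ` are positive. -/
structure IsThinSVD {m d : ℕ} (A U : Matrix (Fin m) (Fin d) ℝ) (σ : Fin d → ℝ)
    (V : Matrix (Fin d) (Fin d) ℝ) : Prop where
  orthU : U.transpose * U = 1
  orthV : V.transpose * V = 1
  pos : ∀ k, 0 < σ k
  eq : A = U * Matrix.diagonal σ * V.transpose

/-- The cross-leverage score `c_ij = ⟨U_(i), U_(j)⟩`, where `U` holds the left singular vectors. -/
def crossScore {n d : ℕ} (U : Matrix (Fin n) (Fin d) ℝ) (i j : Fin n) : ℝ := ∑ k, U i k * U j k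

/-- The leverage score `ℓ_i = ‖U_(i)‖²`. -/
def levScore {n d : ℕ} (U : Matrix (Fin n) (Fin d) ℝ) (i : Fin n) : ℝ := ∑ k, U i k ^ 2

/-- `R⁻¹` orthogonalizes `B` when the columns of `B R⁻¹` are orthonormal.  Both `R⁻¹ = V Σ⁻¹`
(from a thin SVD of `B`) and the inverse of the `R`-factor of a QR factorization qualify. -/
def IsOrthogonalizer {m d : ℕ} (B : Matrix (Fin m) (Fin d) ℝ)
    (Rinv : Matrix (Fin d) (Fin d) ℝ) : Prop :=
  (B * Rinv).transpose * (B * Rinv) = 1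

/-- `V Σ⁻¹` is an orthogonalizer of `B = U Σ Vᵀ`. -/
theorem IsThinSVD.isOrthogonalizer {m d : ℕ} {B U : Matrix (Fin m) (Fin d) ℝ} {σ : Fin d → ℝ}
    {V : Matrix (Fin d) (Fin d) ℝ} (h : IsThinSVD B U σ V) :
    IsOrthogonalizer B (V * Matrix.diagonal fun k => (σ k)⁻¹) := by
  have hU : B * (V * Matrix.diagonal fun k => (σ k)⁻¹) = U := by
    have h1 : B * (V * Matrix.diagonal fun k => (σ k)⁻¹)
        = U * Matrix.diagonal σ * (V.transpose * V) * Matrix.diagonal fun k => (σ k)⁻¹ := by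
      rw [h.eq]; simp only [Matrix.mul_assoc]
    rw [h1, h.orthV, Matrix.mul_one, Matrix.mul_assoc, Matrix.diagonal_mul_diagonal]
    have h2 : (fun k => σ k * (σ k)⁻¹) = fun _ => (1 : ℝ) :=
      funext fun k => mul_inv_cancel₀ (h.pos k).ne'
    rw [h2, Matrix.diagonal_one, Matrix.mul_one]
  unfold IsOrthogonalizer
  rw [hU, h.orthU]

/-! ## The random projections -/

/-- The unnormalized Hadamard matrix of order `2 ^ m`, by the block recursion
`H_1 = 1`, `H_{2N} = [[H_N, H_N], [H_N, -H_N]]`. -/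
def walshHadamard : (m : ℕ) → Matrix (Fin (2 ^ m)) (Fin (2 ^ m)) ℝ
  | 0 => fun _ _ => 1
  | m + 1 =>
    let e : Fin (2 ^ (m + 1)) ≃ Fin (2 ^ m) ⊕ Fin (2 ^ m) :=
      (finCongr (by omega)).trans finSumFinEquiv.symm
    (Matrix.fromBlocks (walshHadamard m) (walshHadamard m)
      (walshHadamard m) (-walshHadamard m)).submatrix e e

/-- The random choices made in building the sketch of an `n × d` matrix, to be drawn uniformly:
`n` independent fair signs, `r₁` independent uniform row indices (with replacement) of the Hadamard
matrix of order `2 ^ ⌈log₂ n⌉`, and a `d × r₂` array of independent rolls of a six-sided die. -/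
abbrev Seed (n d r₁ r₂ : ℕ) : Type :=
  (Fin n → ℤˣ) × (Fin r₁ → Fin (2 ^ Nat.clog 2 n)) × (Fin d → Fin r₂ → Fin 6)

/-- The subsampled randomized Hadamard transform `Π₁ = Sᵀ H D` as an `r × n` matrix.  With
`N = 2 ^ ⌈log₂ n⌉` (so `N = n` when `n` is a power of two, and vectors of length `n` are padded by
zeros to length `N` otherwise), row `t` of `Π₁` is `√(N / r)` times the sampled row `s t` of `H D`,
where `H` is the normalized Hadamard matrix and `D` is the diagonal matrix of the random signs. -/
def srht {n r : ℕ} (sgn : Fin n → ℤˣ) (s : Fin r → Fin (2 ^ Nat.clog 2 n)) :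
    Matrix (Fin r) (Fin n) ℝ := fun t i =>
  Real.sqrt ((2 ^ Nat.clog 2 n : ℝ) / r)
    * (walshHadamard (Nat.clog 2 n) (s t) (Fin.castLE (Nat.le_pow_clog one_lt_two n) i)
        / Real.sqrt (2 ^ Nat.clog 2 n))
    * ((sgn i : ℤ) : ℝ)

/-- The Johnson-Lindenstrauss matrix `Π₂`: from rolls of a fair die, each entry is `√(3/r)` with
probability `1/6`, `-√(3/r)` with probability `1/6`, and `0` with probability `2/3`. -/
def jlt {d r : ℕ} (dice : Fin d → Fin r → Fin 6) : Matrix (Fin d) (Fin r) ℝ := fun k l =>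
  if dice k l = 0 then Real.sqrt (3 / r)
  else if dice k l = 1 then -Real.sqrt (3 / r)
  else 0

/-- The sketch `Ω = A R⁻¹ Π₂`, where `R⁻¹ = Rinv (Π₁ A)` is the orthogonalizer that the
factorization routine `Rinv` computes from `Π₁ A`. -/
def sketch {n d r₁ r₂ : ℕ} (A : Matrix (Fin n) (Fin d) ℝ)
    (Rinv : Matrix (Fin r₁) (Fin d) ℝ → Matrix (Fin d) (Fin d) ℝ) (ω : Seed n d r₁ r₂) :
    Matrix (Fin n) (Fin r₂) ℝ :=
  A * Rinv (srht ω.1 ω.2.1 * A) * jlt ω.2.2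

/-! ## Step counting

A `Timed` computation returns a value together with the number of elementary operations spent.
One unit is charged for each arithmetic operation on reals or indices, each comparison, each access
to an entry of a matrix or array, and each elementary list operation. -/

/-- A value together with the number of steps spent on it. -/
structure Timed (α : Type) where
  ret : α
  time : ℕ

instance : Monad Timed where
  pure x := ⟨x, 0⟩
  bind x f := ⟨(f x.ret).ret, x.time + (f x.ret).time⟩

/-- Spend `k` steps. -/
def tick (k : ℕ) : Timed Unit := ⟨(), k⟩

/-- One elementary operation, with result `x`. -/
def step {α : Type} (x : α) : Timed α := ⟨x, 1⟩

/-! ## Finding the heavy pairs of rows -/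

/-- The inner product of rows `i` and `j` of `X`, coordinate by coordinate. -/
def dot {n r : ℕ} (X : Matrix (Fin n) (Fin r) ℝ) (i j : Fin n) : Timed ℝ :=
  (List.finRange r).foldlM (fun acc k => do
    tick 1
    let a ← step (X i k)
    let b ← step (X j k)
    let p ← step (a * b)
    step (acc + p)) 0

/-- The list of the rows with their squared norms. -/
def rowNorms {n r : ℕ} (X : Matrix (Fin n) (Fin r) ℝ) : Timed (List (ℝ × Fin n)) :=
  (List.finRange n).mapM fun i => do
    let s ← dot X i i
    step (s, i)

/-- Merge two lists that are sorted by their first entries. -/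
def merge {ι : Type} : List (ℝ × ι) → List (ℝ × ι) → Timed (List (ℝ × ι))
  | [], ys => step ys
  | x :: xs, [] => step (x :: xs)
  | x :: xs, y :: ys => do
    let b ← step (decide (x.1 ≤ y.1))
    if b then do
      let t ← merge xs (y :: ys)
      step (x :: t)
    else do
      let t ← merge (x :: xs) ys
      step (y :: t)
termination_by xs ys => xs.length + ys.length

/-- Merge sort by the first entries, in increasing order; halving a list is charged its length. -/
def mergeSort {ι : Type} (l : List (ℝ × ι)) : Timed (List (ℝ × ι)) :=
  if _h : l.length ≤ 1 then step l
  else do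
    tick (l.length + 1)
    let a ← mergeSort (l.take (l.length / 2))
    let b ← mergeSort (l.drop (l.length / 2))
    merge a b
termination_by l.length
decreasing_by
  all_goals simp only [List.length_take, List.length_drop]; omega

/-- For the fixed row `i`, go through the rows at positions `p, …, z₁ - 1` of the sorted array `a`,
and add to `H` each pair whose squared inner product reaches the threshold `τ`, together with the
inner product as the estimate. -/
def scanRow {n r : ℕ} (X : Matrix (Fin n) (Fin r) ℝ) (τ : ℝ) (a : Array (ℝ × Fin n)) (i : Fin n)
    (z₁ : ℕ) (hz : z₁ ≤ a.size) (p : ℕ) (H : List (Sym2 (Fin n) × ℝ)) :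
    Timed (List (Sym2 (Fin n) × ℝ)) := do
  tick 1
  if _h : p < z₁ then do
    let j ← step (a[p]'(by omega)).2
    let c ← dot X i j
    let q ← step (c * c)
    let b ← step (decide (τ ≤ q))
    let H' ← step (if b then (s(i, j), c) :: H else H)
    tick 1
    scanRow X τ a i z₁ hz (p + 1) H'
  else pure H
termination_by z₁ - p

/-- The two-pointer loop over the array `a` of rows sorted by norm.  Positions start at `0`; the
rows still under consideration are at positions `z₂, …, z₁ - 1`, and the largest of them (position
`z₁ - 1`) is the current row.  If the current row and the row at `z₂` are not norm-heavy, `z₂` is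
increased; otherwise all pairs of the current row with the rows at `z₂, …, z₁ - 1` (itself
included) are norm-heavy: they are scanned, and `z₁` is decreased. -/
def heavyLoop {n r : ℕ} (X : Matrix (Fin n) (Fin r) ℝ) (τ : ℝ) (a : Array (ℝ × Fin n))
    (z₁ : ℕ) (hz : z₁ ≤ a.size) (z₂ : ℕ) (H : List (Sym2 (Fin n) × ℝ)) :
    Timed (List (Sym2 (Fin n) × ℝ)) := do
  tick 1
  if _h : z₂ < z₁ then do
    let u ← step (a[z₁ - 1]'(by omega))
    let v ← step (a[z₂]'(by omega))
    let q ← step (u.1 * v.1)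
    let b ← step (decide (q < τ))
    if b then do
      tick 1
      heavyLoop X τ a z₁ hz (z₂ + 1) H
    else do
      let H' ← scanRow X τ a u.2 z₁ hz z₂ H
      tick 1
      heavyLoop X τ a (z₁ - 1) (by omega) z₂ H'
  else pure H
termination_by z₁ - z₂

/-- The heavy-pairs algorithm: compute the row norms, sort the rows by norm, run the two-pointer
loop.  It returns unordered pairs of rows of `X`, with their inner products as estimates. The
threshold `τ` stands for `‖Xᵀ X‖_F² / κ'`. -/
def heavyPairs {n r : ℕ} (X : Matrix (Fin n) (Fin r) ℝ) (τ : ℝ) :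
    Timed (List (Sym2 (Fin n) × ℝ)) := do
  let l ← rowNorms X
  let l' ← mergeSort l
  tick (l'.length + 1)
  heavyLoop X τ l'.toArray l'.toArray.size le_rfl 0 []

/-- The part of the algorithm that follows the computation of the sketch `Ω`: return the
`κ'`-heavy pairs of `Ω` for `κ' = κ ‖Ωᵀ Ω‖_F² / d`, for which the threshold
`‖Ωᵀ Ω‖_F² / κ'` is `d / κ`. -/
def crossLeverage {n r : ℕ} (d : ℕ) (κ : ℝ) (X : Matrix (Fin n) (Fin r) ℝ) :
    Timed (List (Sym2 (Fin n) × ℝ)) := do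
  let τ ← step ((d : ℝ) / κ)
  heavyPairs X τ

end

end CrossLev

open CrossLev

/-!
The argument splits into an analysis of the sketch, in which all the randomness sits, and a
deterministic analysis of the algorithm.

**The sketch.** Write `A R⁻¹ = U M`. Since the columns of `Π₁ A R⁻¹` are orthonormal,
`M Mᵀ = ((Π₁ U)ᵀ (Π₁ U))⁻¹`. If the Gram matrix is within `ε / 2` of the identity in operator norm,
the inner products of the rows of `A R⁻¹` are within `ε √(ℓ_i ℓ_j)` of the cross-leverage scores
(`abs_dotProduct_rows_sub_le`). The sparse sign matrix `Π₂` preserves these inner products up to the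
same order (`prob_jlt_inner`), so `|c̃_ij - c_ij| ≤ (7/4) ε √(ℓ_i ℓ_j)`, and squaring costs a
further constant.

That the Gram matrix is close to the identity is shown in two steps. By Hoeffding's inequality, the
random signs make all rows of `H D U` have squared norm at most `18 d log n / N`
(`prob_hadamardRow_large`). For uniform sampling from such rows a matrix concentration inequality
is needed (`prob_sample_covariance`); it is obtained by the moment method. For
`S = ∑ Y (s t)` with independent centred symmetric terms, exchanging one sample with a fresh copy
gives
`E tr S ^ (q + 1) = (1/2) ∑ E tr (S - S') (S ^ q - S' ^ q)`, and a mean value inequality for traces,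
which in a joint spectral decomposition is a scalar inequality, bounds the right-hand side by
`q ∑ E tr (S - S')² S ^ (q - 1)`. As `Y² ≤ μ Y + (μ + 1)`, this is a recursion among the trace
moments of `S` (`sum_trace_pow_le`), which closes at order `q + 1 ≈ 2 log₂ d`.

The exponential moment that underlies `prob_jlt_inner` comes from the Gaussian representation of
`exp (z² / 12)`. Probabilities are averages over finite types.

**The algorithm.** The two-pointer loop drops a row only when its norm times the largest remaining
norm is below the threshold, so by the Cauchy-Schwarz inequality no pair with `c̃_ij² ≥ d / κ` is
lost (`heavyLoop_complete`). Each pair that it scans has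
`‖Ω_i‖² ‖Ω_j‖² ≥ d / κ`, so at most `(∑ ‖Ω_i‖²)² κ / d ≤ 4 d κ` pairs are scanned, at `O(r₂)` steps
each (`heavyLoop_time`).
-/

namespace CrossLev

/-! ### The algorithm: sorting and the two-pointer loop -/

@[simp] theorem Timed.ret_bind {α β : Type} (x : Timed α) (f : α → Timed β) :
    (x >>= f).ret = (f x.ret).ret := rfl
@[simp] theorem Timed.time_bind {α β : Type} (x : Timed α) (f : α → Timed β) :
    (x >>= f).time = x.time + (f x.ret).time := rfl
@[simp] theorem Timed.ret_pure {α : Type} (x : α) : (pure x : Timed α).ret = x := rfl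
@[simp] theorem Timed.time_pure {α : Type} (x : α) : (pure x : Timed α).time = 0 := rfl
@[simp] theorem Timed.ret_map {α β : Type} (f : α → β) (x : Timed α) :
    (f <$> x).ret = f x.ret := rfl
@[simp] theorem Timed.time_map {α β : Type} (f : α → β) (x : Timed α) :
    (f <$> x).time = x.time := rfl
@[simp] theorem ret_step {α : Type} (x : α) : (step x).ret = x := rfl
@[simp] theorem time_step {α : Type} (x : α) : (step x).time = 1 := rfl
@[simp] theorem time_tick (k : ℕ) : (tick k).time = k := rfl

theorem Timed.ext {α : Type} {x y : Timed α} (h : x.ret = y.ret) (h' : x.time = y.time) :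
    x = y := by
  cases x; cases y; simp_all

instance : LawfulMonad Timed := LawfulMonad.mk'
  (id_map := fun x => Timed.ext rfl (Nat.add_zero _))
  (pure_bind := fun x f => Timed.ext rfl (Nat.zero_add _))
  (bind_assoc := fun x f g => Timed.ext rfl (Nat.add_assoc _ _ _))

/-- The value and the running time of an inner product, for a general accumulator. -/
theorem dot_foldlM {n r : ℕ} (X : Matrix (Fin n) (Fin r) ℝ) (i j : Fin n) (l : List (Fin r))
    (acc : ℝ) :
    (l.foldlM (fun acc k => do
      tick 1
      let a ← step (X i k)
      let b ← step (X j k)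
      let p ← step (a * b)
      step (acc + p)) acc : Timed ℝ) =
    ⟨acc + (l.map fun k => X i k * X j k).sum, 5 * l.length⟩ := by
  induction l generalizing acc with
  | nil => apply Timed.ext <;> simp
  | cons k l ih =>
    rw [List.foldlM_cons]
    apply Timed.ext
    · simp [ih, add_assoc]
    · simp [ih]; ring

theorem dot_eq {n r : ℕ} (X : Matrix (Fin n) (Fin r) ℝ) (i j : Fin n) :
    dot X i j = ⟨∑ k, X i k * X j k, 5 * r⟩ := by
  unfold dot
  rw [dot_foldlM, ← List.ofFn_eq_map, List.sum_ofFn]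
  simp

theorem rowNorms_mapM {n r : ℕ} (X : Matrix (Fin n) (Fin r) ℝ) (l : List (Fin n)) :
    (l.mapM fun i => do
      let s ← dot X i i
      step (s, i) : Timed (List (ℝ × Fin n))) =
    ⟨l.map fun i => (∑ k, X i k * X i k, i), (5 * r + 1) * l.length⟩ := by
  induction l with
  | nil => apply Timed.ext <;> simp
  | cons i l ih =>
    rw [List.mapM_cons, ih]
    apply Timed.ext
    · simp [dot_eq]
    · simp [dot_eq]; ring

theorem rowNorms_eq {n r : ℕ} (X : Matrix (Fin n) (Fin r) ℝ) :
    rowNorms X = ⟨List.ofFn fun i => (∑ k, X i k * X i k, i), (5 * r + 1) * n⟩ := by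
  unfold rowNorms
  rw [rowNorms_mapM, List.ofFn_eq_map]
  simp

/-- A list of pairs is in increasing order of first entries. -/
abbrev SortedByFst {ι : Type} (l : List (ℝ × ι)) : Prop := l.Pairwise fun x y => x.1 ≤ y.1

theorem merge_of_le {ι : Type} {x y : ℝ × ι} (xs ys : List (ℝ × ι)) (h : x.1 ≤ y.1) :
    merge (x :: xs) (y :: ys) =
      ⟨x :: (merge xs (y :: ys)).ret, (merge xs (y :: ys)).time + 2⟩ := by
  rw [merge, decide_eq_true h]
  exact Timed.ext rfl (Nat.add_comm _ _)

theorem merge_of_lt {ι : Type} {x y : ℝ × ι} (xs ys : List (ℝ × ι)) (h : y.1 < x.1) :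
    merge (x :: xs) (y :: ys) =
      ⟨y :: (merge (x :: xs) ys).ret, (merge (x :: xs) ys).time + 2⟩ := by
  rw [merge, decide_eq_false h.not_ge]
  exact Timed.ext rfl (Nat.add_comm _ _)

theorem merge_perm {ι : Type} (xs ys : List (ℝ × ι)) : (merge xs ys).ret.Perm (xs ++ ys) := by
  induction xs, ys using merge.induct with
  | case1 ys => simp [merge]
  | case2 x xs => simp [merge]
  | case3 x xs y ys ih1 ih2 =>
    rcases le_or_gt x.1 y.1 with h | h
    · rw [merge_of_le _ _ h]
      simpa using ih1
    · rw [merge_of_lt _ _ h]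
      exact (List.Perm.cons y ih2).trans List.perm_middle.symm

theorem merge_sorted {ι : Type} (xs ys : List (ℝ × ι)) (hx : SortedByFst xs)
    (hy : SortedByFst ys) : SortedByFst (merge xs ys).ret := by
  induction xs, ys using merge.induct with
  | case1 ys => simpa [merge] using hy
  | case2 x xs => rw [merge]; exact hx
  | case3 x xs y ys ih1 ih2 =>
    have hx' := List.pairwise_cons.1 hx
    have hy' := List.pairwise_cons.1 hy
    rcases le_or_gt x.1 y.1 with h | h
    · rw [merge_of_le _ _ h]
      refine List.pairwise_cons.2 ⟨fun z hz => ?_, ih1 hx'.2 hy⟩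
      rcases List.mem_append.1 ((merge_perm _ _).mem_iff.1 hz) with hz | hz
      · exact hx'.1 z hz
      · rcases List.mem_cons.1 hz with rfl | hz
        · exact h
        · exact h.trans (hy'.1 z hz)
    · rw [merge_of_lt _ _ h]
      refine List.pairwise_cons.2 ⟨fun z hz => ?_, ih2 hx hy'.2⟩
      rcases List.mem_append.1 ((merge_perm _ _).mem_iff.1 hz) with hz | hz
      · rcases List.mem_cons.1 hz with rfl | hz
        · exact h.le
        · exact h.le.trans (hx'.1 z hz)
      · exact hy'.1 z hz

theorem merge_time {ι : Type} (xs ys : List (ℝ × ι)) :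
    (merge xs ys).time ≤ 2 * (xs.length + ys.length) + 1 := by
  induction xs, ys using merge.induct with
  | case1 ys => simp [merge]
  | case2 x xs => simp [merge]
  | case3 x xs y ys ih1 ih2 =>
    simp only [List.length_cons] at ih1 ih2 ⊢
    rcases le_or_gt x.1 y.1 with h | h
    · rw [merge_of_le _ _ h]
      dsimp only
      omega
    · rw [merge_of_lt _ _ h]
      dsimp only
      omega

theorem mergeSort_perm {ι : Type} (l : List (ℝ × ι)) : (mergeSort l).ret.Perm l := by
  fun_induction mergeSort l with
  | case1 l h => simp
  | case2 l h ih1 ih2 =>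
    simp only [Timed.ret_bind]
    refine (merge_perm _ _).trans ((ih1.append ih2).trans ?_)
    rw [List.take_append_drop]

theorem mergeSort_sorted {ι : Type} (l : List (ℝ × ι)) : SortedByFst (mergeSort l).ret := by
  fun_induction mergeSort l with
  | case1 l h =>
    rcases l with _ | ⟨a, _ | ⟨b, l⟩⟩
    · exact List.Pairwise.nil
    · exact List.pairwise_singleton _ _
    · simp at h
  | case2 l h ih1 ih2 => exact merge_sorted _ _ ih1 ih2

theorem mergeSort_time {ι : Type} (l : List (ℝ × ι)) :
    (mergeSort l).time ≤ 5 * l.length * Nat.clog 2 l.length + 1 := by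
  fun_induction mergeSort l with
  | case1 l h => simp
  | case2 l h ih1 ih2 =>
    simp only [Timed.time_bind, time_tick]
    have hm := merge_time (mergeSort (List.take (l.length / 2) l)).ret
      (mergeSort (List.drop (l.length / 2) l)).ret
    rw [(mergeSort_perm _).length_eq, (mergeSort_perm _).length_eq] at hm
    simp only [List.length_take, List.length_drop] at ih1 ih2 hm
    have hc : Nat.clog 2 l.length = Nat.clog 2 ((l.length + 2 - 1) / 2) + 1 :=
      Nat.clog_of_two_le (by norm_num) (by omega)
    have h1 : min (l.length / 2) l.length = l.length / 2 := by omega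
    have h2 : l.length - l.length / 2 = (l.length + 2 - 1) / 2 := by omega
    rw [h1] at ih1 hm
    rw [h2] at ih2 hm
    have h3 : Nat.clog 2 (l.length / 2) ≤ Nat.clog 2 ((l.length + 2 - 1) / 2) :=
      Nat.clog_mono_right 2 (by omega)
    have h4 : l.length = l.length / 2 + (l.length + 2 - 1) / 2 := by omega
    rw [hc]
    generalize Nat.clog 2 ((l.length + 2 - 1) / 2) = k at *
    generalize Nat.clog 2 (l.length / 2) = k' at *
    have h5 := Nat.mul_le_mul_left (5 * (l.length / 2)) h3
    have h6 : 5 * l.length * (k + 1)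
        = 5 * (l.length / 2) * k + 5 * ((l.length + 2 - 1) / 2) * k + 5 * l.length := by
      conv_lhs => rw [h4]
      ring_nf
      omega
    rw [h6]
    omega

section Loop

variable {n r : ℕ} (X : Matrix (Fin n) (Fin r) ℝ) (τ : ℝ) (a : Array (ℝ × Fin n))

theorem scanRow_of_le (i : Fin n) (z₁ : ℕ) (hz : z₁ ≤ a.size) (p : ℕ)
    (H : List (Sym2 (Fin n) × ℝ)) (h : z₁ ≤ p) : scanRow X τ a i z₁ hz p H = ⟨H, 1⟩ := by
  rw [scanRow, dif_neg (by omega)]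
  rfl

open Classical in
theorem scanRow_of_lt (i : Fin n) (z₁ : ℕ) (hz : z₁ ≤ a.size) (p : ℕ)
    (H : List (Sym2 (Fin n) × ℝ)) (h : p < z₁) :
    scanRow X τ a i z₁ hz p H =
      ⟨(scanRow X τ a i z₁ hz (p + 1)
          (if τ ≤ (∑ k, X i k * X (a[p]'(by omega)).2 k) ^ 2 then
            (s(i, (a[p]'(by omega)).2), ∑ k, X i k * X (a[p]'(by omega)).2 k) :: H else H)).ret,
        (scanRow X τ a i z₁ hz (p + 1)
          (if τ ≤ (∑ k, X i k * X (a[p]'(by omega)).2 k) ^ 2 then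
            (s(i, (a[p]'(by omega)).2), ∑ k, X i k * X (a[p]'(by omega)).2 k) :: H
            else H)).time + (5 * r + 6)⟩ := by
  rw [scanRow, dif_pos h]
  simp only [dot_eq, sq]
  by_cases ht : τ ≤ (∑ k, X i k * X (a[p]'(by omega)).2 k) *
      ∑ k, X i k * X (a[p]'(by omega)).2 k
  · rw [if_pos ht]
    change (tick 1 >>= fun _ => step _ >>= fun _ => Timed.mk _ _ >>= fun _ =>
      step _ >>= fun _ => step (decide (τ ≤ (∑ k, X i k * X (a[p]'(by omega)).2 k) *
      ∑ k, X i k * X (a[p]'(by omega)).2 k)) >>= _) = _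
    rw [decide_eq_true ht]
    refine Timed.ext rfl ?_
    simp only [Timed.time_bind, time_tick, time_step, ret_step, if_true]
    omega
  · rw [if_neg ht]
    change (tick 1 >>= fun _ => step _ >>= fun _ => Timed.mk _ _ >>= fun _ =>
      step _ >>= fun _ => step (decide (τ ≤ (∑ k, X i k * X (a[p]'(by omega)).2 k) *
      ∑ k, X i k * X (a[p]'(by omega)).2 k)) >>= _) = _
    rw [decide_eq_false ht]
    refine Timed.ext rfl ?_
    simp only [Timed.time_bind, time_tick, time_step, ret_step, Bool.false_eq_true, if_false]
    omega

theorem scanRow_time (i : Fin n) (z₁ : ℕ) (hz : z₁ ≤ a.size) (p : ℕ)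
    (H : List (Sym2 (Fin n) × ℝ)) :
    (scanRow X τ a i z₁ hz p H).time ≤ (5 * r + 6) * (z₁ - p) + 1 := by
  induction hk : z₁ - p generalizing p H with
  | zero =>
    rw [scanRow_of_le _ _ _ _ _ _ _ _ (by omega)]
    simp
  | succ k ih =>
    rw [scanRow_of_lt _ _ _ _ _ _ _ _ (by omega)]
    refine (Nat.add_le_add_right (ih _ _ (by omega)) _).trans ?_
    rw [Nat.mul_succ]
    omega

/-- The scan keeps what was collected, and adds a pair only with its inner product, and only
if the square of that inner product reaches the threshold. -/
theorem mem_scanRow (i : Fin n) (z₁ : ℕ) (hz : z₁ ≤ a.size) (p : ℕ)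
    (H : List (Sym2 (Fin n) × ℝ)) (x : Sym2 (Fin n) × ℝ) :
    x ∈ (scanRow X τ a i z₁ hz p H).ret ↔ x ∈ H ∨ ∃ q, ∃ h : p ≤ q ∧ q < z₁,
      x = (s(i, (a[q]'(by omega)).2), ∑ k, X i k * X (a[q]'(by omega)).2 k) ∧
      τ ≤ (∑ k, X i k * X (a[q]'(by omega)).2 k) ^ 2 := by
  induction hk : z₁ - p generalizing p H with
  | zero =>
    rw [scanRow_of_le _ _ _ _ _ _ _ _ (by omega)]
    refine ⟨Or.inl, ?_⟩
    rintro (h | ⟨q, h, -⟩)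
    · exact h
    · omega
  | succ k ih =>
    rw [scanRow_of_lt _ _ _ _ _ _ _ _ (by omega)]
    dsimp only
    rw [ih _ _ (by omega)]
    constructor
    · rintro (h | ⟨q, h, h'⟩)
      · split at h
        · rename_i ht
          rcases List.mem_cons.1 h with rfl | h
          · exact Or.inr ⟨p, ⟨le_rfl, by omega⟩, rfl, ht⟩
          · exact Or.inl h
        · exact Or.inl h
      · exact Or.inr ⟨q, ⟨by omega, h.2⟩, h'⟩
    · rintro (h | ⟨q, h, h', ht⟩)
      · left; split
        · exact List.mem_cons_of_mem _ h
        · exact h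
      · rcases eq_or_lt_of_le h.1 with rfl | hpq
        · left
          rw [if_pos ht, h']
          exact List.mem_cons_self
        · exact Or.inr ⟨q, ⟨hpq, h.2⟩, h', ht⟩

theorem heavyLoop_of_le (z₁ : ℕ) (hz : z₁ ≤ a.size) (z₂ : ℕ)
    (H : List (Sym2 (Fin n) × ℝ)) (h : z₁ ≤ z₂) : heavyLoop X τ a z₁ hz z₂ H = ⟨H, 1⟩ := by
  rw [heavyLoop, dif_neg (by omega)]
  rfl

theorem heavyLoop_skip (z₁ : ℕ) (hz : z₁ ≤ a.size) (z₂ : ℕ)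
    (H : List (Sym2 (Fin n) × ℝ)) (h : z₂ < z₁)
    (hlt : (a[z₁ - 1]'(by omega)).1 * (a[z₂]'(by omega)).1 < τ) :
    heavyLoop X τ a z₁ hz z₂ H = ⟨(heavyLoop X τ a z₁ hz (z₂ + 1) H).ret,
      (heavyLoop X τ a z₁ hz (z₂ + 1) H).time + 6⟩ := by
  rw [heavyLoop, dif_pos h]
  change (tick 1 >>= fun _ => step _ >>= fun _ => step _ >>= fun _ => step _ >>= fun _ =>
    step (decide ((a[z₁ - 1]'(by omega)).1 * (a[z₂]'(by omega)).1 < τ)) >>= _) = _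
  rw [decide_eq_true hlt]
  refine Timed.ext rfl ?_
  simp only [Timed.time_bind, time_tick, time_step, ret_step, if_true]
  omega

theorem heavyLoop_scan (z₁ : ℕ) (hz : z₁ ≤ a.size) (z₂ : ℕ)
    (H : List (Sym2 (Fin n) × ℝ)) (h : z₂ < z₁)
    (hle : τ ≤ (a[z₁ - 1]'(by omega)).1 * (a[z₂]'(by omega)).1) :
    heavyLoop X τ a z₁ hz z₂ H =
      ⟨(heavyLoop X τ a (z₁ - 1) (by omega) z₂
          (scanRow X τ a (a[z₁ - 1]'(by omega)).2 z₁ hz z₂ H).ret).ret,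
        (heavyLoop X τ a (z₁ - 1) (by omega) z₂
          (scanRow X τ a (a[z₁ - 1]'(by omega)).2 z₁ hz z₂ H).ret).time +
        (scanRow X τ a (a[z₁ - 1]'(by omega)).2 z₁ hz z₂ H).time + 6⟩ := by
  rw [heavyLoop, dif_pos h]
  change (tick 1 >>= fun _ => step _ >>= fun _ => step _ >>= fun _ => step _ >>= fun _ =>
    step (decide ((a[z₁ - 1]'(by omega)).1 * (a[z₂]'(by omega)).1 < τ)) >>= _) = _
  rw [decide_eq_false hle.not_gt]
  refine Timed.ext rfl ?_
  simp only [Timed.time_bind, time_tick, time_step, ret_step, Bool.false_eq_true, if_false]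
  omega

/-- Soundness, for an invariant `P` that holds for each pair whose squared inner product reaches
the threshold. -/
theorem heavyLoop_sound (z₁ : ℕ) (hz : z₁ ≤ a.size) (z₂ : ℕ)
    (H : List (Sym2 (Fin n) × ℝ)) (P : Sym2 (Fin n) × ℝ → Prop) (hH : ∀ x ∈ H, P x)
    (hP : ∀ i j, τ ≤ (∑ k, X i k * X j k) ^ 2 → P (s(i, j), ∑ k, X i k * X j k)) :
    ∀ x ∈ (heavyLoop X τ a z₁ hz z₂ H).ret, P x := by
  induction hk : z₁ - z₂ generalizing z₁ z₂ H with
  | zero =>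
    rw [heavyLoop_of_le _ _ _ _ _ _ _ (by omega)]
    exact hH
  | succ k ih =>
    rcases lt_or_ge ((a[z₁ - 1]'(by omega)).1 * (a[z₂]'(by omega)).1) τ with hlt | hlt
    · rw [heavyLoop_skip _ _ _ _ _ _ _ (by omega) hlt]
      exact ih _ _ _ _ hH (by omega)
    · rw [heavyLoop_scan _ _ _ _ _ _ _ (by omega) hlt]
      refine ih _ _ _ _ (fun x hx => ?_) (by omega)
      rcases (mem_scanRow X τ a _ z₁ hz _ _ x).1 hx with h | ⟨q, h, rfl, ht⟩
      · exact hH x h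
      · exact hP _ _ ht

theorem subset_heavyLoop (z₁ : ℕ) (hz : z₁ ≤ a.size) (z₂ : ℕ)
    (H : List (Sym2 (Fin n) × ℝ)) : ∀ x ∈ H, x ∈ (heavyLoop X τ a z₁ hz z₂ H).ret := by
  induction hk : z₁ - z₂ generalizing z₁ z₂ H with
  | zero =>
    rw [heavyLoop_of_le _ _ _ _ _ _ _ (by omega)]
    exact fun x hx => hx
  | succ k ih =>
    intro x hx
    rcases lt_or_ge ((a[z₁ - 1]'(by omega)).1 * (a[z₂]'(by omega)).1) τ with hlt | hlt
    · rw [heavyLoop_skip _ _ _ _ _ _ _ (by omega) hlt]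
      exact ih _ _ _ _ (by omega) x hx
    · rw [heavyLoop_scan _ _ _ _ _ _ _ (by omega) hlt]
      exact ih _ _ _ _ (by omega) x ((mem_scanRow X τ a _ z₁ hz _ _ x).2 (Or.inl hx))

variable {a}

theorem getElem_fst_mono (ha : SortedByFst a.toList) {p q : ℕ} (hpq : p ≤ q) (hq : q < a.size) :
    (a[p]'(by omega)).1 ≤ (a[q]).1 := by
  rcases eq_or_lt_of_le hpq with rfl | h
  · rfl
  · exact List.pairwise_iff_getElem.1 ha p q (by simpa using by omega) (by simpa using hq) h

/-- The loop misses no pair: a position is dropped by `z₂` only when its product with the largest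
remaining norm is below the threshold. -/
theorem heavyLoop_complete (ha : SortedByFst a.toList) (h0 : ∀ p, ∀ h : p < a.size, 0 ≤ (a[p]).1)
    (z₁ : ℕ) (hz : z₁ ≤ a.size) (z₂ : ℕ)
    (H : List (Sym2 (Fin n) × ℝ)) (p q : ℕ) (h2p : z₂ ≤ p) (hpq : p ≤ q) (hq : q < z₁)
    (hpr : τ ≤ (a[q]'(by omega)).1 * (a[p]'(by omega)).1)
    (hdot : τ ≤ (∑ k, X (a[q]'(by omega)).2 k * X (a[p]'(by omega)).2 k) ^ 2) :
    ∃ c, (s((a[q]'(by omega)).2, (a[p]'(by omega)).2), c) ∈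
      (heavyLoop X τ a z₁ hz z₂ H).ret := by
  induction hk : z₁ - z₂ generalizing z₁ z₂ H with
  | zero => omega
  | succ k ih =>
    rcases lt_or_ge ((a[z₁ - 1]'(by omega)).1 * (a[z₂]'(by omega)).1) τ with hlt | hlt
    · rw [heavyLoop_skip _ _ _ _ _ _ _ (by omega) hlt]
      refine ih _ _ _ _ ?_ hq hpr hdot (by omega)
      rcases eq_or_lt_of_le h2p with rfl | h
      · exfalso
        have := mul_le_mul_of_nonneg_right (getElem_fst_mono ha (show q ≤ z₁ - 1 by omega)
          (by omega)) (h0 z₂ (by omega))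
        linarith
      · exact h
    · rw [heavyLoop_scan _ _ _ _ _ _ _ (by omega) hlt]
      rcases eq_or_lt_of_le (show q ≤ z₁ - 1 by omega) with rfl | h
      · exact ⟨_, subset_heavyLoop X τ a _ _ _ _ _ ((mem_scanRow X τ a _ z₁ hz _ _ _).2
          (Or.inr ⟨p, ⟨h2p, by omega⟩, rfl, hdot⟩))⟩
      · exact ih _ _ _ _ h2p (by omega) hpr hdot (by omega)

/-- Each scanned pair of positions has product of entries at least `τ`, so the number of the
pairs scanned is at most `T * ∑ q < z₁, a_q / τ`, where `T` bounds the sum of all entries. -/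
theorem heavyLoop_time (ha : SortedByFst a.toList) (h0 : ∀ p, ∀ h : p < a.size, 0 ≤ (a[p]).1)
    (hτ : 0 < τ) {T : ℝ} (hT : (a.toList.map Prod.fst).sum ≤ T) (hT0 : 0 ≤ T)
    (z₁ : ℕ) (hz : z₁ ≤ a.size) (z₂ : ℕ) (H : List (Sym2 (Fin n) × ℝ)) :
    ((heavyLoop X τ a z₁ hz z₂ H).time : ℝ) ≤ 1 + 7 * ((z₁ - z₂ : ℕ) : ℝ) +
      (5 * r + 6) * (T / τ) * ((a.toList.take z₁).map Prod.fst).sum := by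
  have hs0 : ∀ z, 0 ≤ ((a.toList.take z).map Prod.fst).sum := by
    intro z
    apply List.sum_nonneg
    intro x hx
    obtain ⟨y, hy, rfl⟩ := List.mem_map.1 hx
    obtain ⟨p, hp, rfl⟩ := List.getElem_of_mem (List.mem_of_mem_take hy)
    exact h0 p (by simpa using hp)
  induction hk : z₁ - z₂ generalizing z₁ z₂ H with
  | zero =>
    rw [heavyLoop_of_le _ _ _ _ _ _ _ (by omega)]
    have := mul_nonneg (mul_nonneg (show (0 : ℝ) ≤ 5 * r + 6 by positivity)
      (show 0 ≤ T / τ by positivity)) (hs0 z₁)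
    simpa using this
  | succ k ih =>
    rcases lt_or_ge ((a[z₁ - 1]'(by omega)).1 * (a[z₂]'(by omega)).1) τ with hlt | hlt
    · have := ih z₁ hz (z₂ + 1) H (by omega)
      rw [heavyLoop_skip _ _ _ _ _ _ _ (by omega) hlt]
      push_cast
      linarith
    · rw [heavyLoop_scan _ _ _ _ _ _ _ (by omega) hlt]
      have h1 := ih (z₁ - 1) (by omega) z₂
        (scanRow X τ a (a[z₁ - 1]'(by omega)).2 z₁ hz z₂ H).ret (by omega)
      have h2 : ((scanRow X τ a (a[z₁ - 1]'(by omega)).2 z₁ hz z₂ H).time : ℝ) ≤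
          (5 * r + 6) * ((z₁ - z₂ : ℕ) : ℝ) + 1 := by
        exact_mod_cast scanRow_time X τ a (a[z₁ - 1]'(by omega)).2 z₁ hz z₂ H
      set u := (a[z₁ - 1]'(by omega)).1 with hu
      have hu0 : 0 ≤ u := h0 _ _
      -- the entries at positions `z₂, …, z₁ - 1` are each at least `τ / u`
      have h3 : ((z₁ - z₂ : ℕ) : ℝ) * τ ≤ u * T := by
        have hlen : (((a.toList.take z₁).drop z₂).map fun x => u * x.1).length = z₁ - z₂ := by
          simp; omega
        have hle : ((z₁ - z₂ : ℕ) : ℝ) * τ ≤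
            (((a.toList.take z₁).drop z₂).map fun x => u * x.1).sum := by
          rw [← hlen, ← nsmul_eq_mul]
          refine List.card_nsmul_le_sum _ _ fun x hx => ?_
          obtain ⟨y, hy, rfl⟩ := List.mem_map.1 hx
          obtain ⟨p, hp, rfl⟩ := List.getElem_of_mem hy
          simp only [List.length_drop, List.length_take, Array.length_toList] at hp
          simp only [List.getElem_drop, List.getElem_take, Array.getElem_toList]
          exact hlt.trans (mul_le_mul_of_nonneg_left
            (getElem_fst_mono ha (by omega) (by omega)) hu0)
        rw [List.sum_map_mul_left] at hle
        refine hle.trans (mul_le_mul_of_nonneg_left (le_trans ?_ hT) hu0)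
        refine List.Sublist.sum_le_sum (((List.drop_sublist _ _).trans
          (List.take_sublist _ _)).map _) fun x hx => ?_
        obtain ⟨y, hy, rfl⟩ := List.mem_map.1 hx
        obtain ⟨p, hp, rfl⟩ := List.getElem_of_mem hy
        exact h0 p (by simpa using hp)
      have h4 : ((a.toList.take z₁).map Prod.fst).sum =
          ((a.toList.take (z₁ - 1)).map Prod.fst).sum + u := by
        have : z₁ = (z₁ - 1) + 1 := by omega
        conv_lhs => rw [this, List.take_succ_eq_append_getElem (by simp; omega)]
        simp [hu]
      rw [h4]
      have h5 : ((z₁ - z₂ : ℕ) : ℝ) ≤ T / τ * u := by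
        rw [div_mul_eq_mul_div, le_div_iff₀ hτ]; linarith
      have h6 := mul_le_mul_of_nonneg_left h5 (show (0 : ℝ) ≤ 5 * r + 6 by positivity)
      push_cast
      rw [mul_add]
      linarith

end Loop

section Algorithm

variable {n r : ℕ} (X : Matrix (Fin n) (Fin r) ℝ) (d : ℕ) (κ : ℝ)

theorem mergeSort_rowNorms_perm : (mergeSort (rowNorms X).ret).ret.Perm
    (List.ofFn fun i => (∑ k, X i k * X i k, i)) := by
  have := mergeSort_perm (rowNorms X).ret
  rwa [rowNorms_eq] at this ⊢

theorem crossLeverage_ret : (crossLeverage d κ X).ret =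
    (heavyLoop X (d / κ) (mergeSort (rowNorms X).ret).ret.toArray
      (mergeSort (rowNorms X).ret).ret.toArray.size le_rfl 0 []).ret := rfl

theorem crossLeverage_sound {i j : Fin n} {c : ℝ}
    (h : (s(i, j), c) ∈ (crossLeverage d κ X).ret) :
    c = ∑ k, X i k * X j k ∧ d / κ ≤ c ^ 2 := by
  rw [crossLeverage_ret] at h
  refine heavyLoop_sound X (d / κ) _ _ _ _ [] (fun x => ∀ i j, x.1 = s(i, j) →
    x.2 = ∑ k, X i k * X j k ∧ d / κ ≤ x.2 ^ 2) (by simp) ?_ _ h i j rfl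
  intro i j hij i' j' he
  refine ⟨?_, hij⟩
  rcases Sym2.eq_iff.1 he with ⟨rfl, rfl⟩ | ⟨rfl, rfl⟩
  · rfl
  · simp only [mul_comm]

theorem mem_sorted_rowNorms (x : ℝ × Fin n) (hx : x ∈ (mergeSort (rowNorms X).ret).ret) :
    x.1 = ∑ k, X x.2 k * X x.2 k := by
  rw [(mergeSort_rowNorms_perm X).mem_iff, List.mem_ofFn] at hx
  obtain ⟨i, rfl⟩ := hx
  rfl

theorem sorted_rowNorms_nonneg (p : ℕ) (h : p < (mergeSort (rowNorms X).ret).ret.toArray.size) :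
    0 ≤ ((mergeSort (rowNorms X).ret).ret.toArray[p]).1 := by
  rw [mem_sorted_rowNorms X _ (by simp)]
  exact Finset.sum_nonneg fun k _ => mul_self_nonneg _

theorem crossLeverage_complete {i j : Fin n} (h : d / κ ≤ (∑ k, X i k * X j k) ^ 2) :
    ∃ c, (s(i, j), c) ∈ (crossLeverage d κ X).ret := by
  rw [crossLeverage_ret]
  have hmem : ∀ i : Fin n, ∃ p, ∃ h : p < (mergeSort (rowNorms X).ret).ret.toArray.size,
      (mergeSort (rowNorms X).ret).ret.toArray[p].2 = i := by
    intro i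
    have : (∑ k, X i k * X i k, i) ∈ (mergeSort (rowNorms X).ret).ret := by
      rw [(mergeSort_rowNorms_perm X).mem_iff, List.mem_ofFn]
      exact ⟨i, rfl⟩
    obtain ⟨p, hp, he⟩ := List.getElem_of_mem this
    exact ⟨p, by simpa using hp, by simp [he]⟩
  obtain ⟨p, hp, rfl⟩ := hmem i
  obtain ⟨q, hq, rfl⟩ := hmem j
  have hs : SortedByFst (mergeSort (rowNorms X).ret).ret.toArray.toList := mergeSort_sorted _
  have h0 := sorted_rowNorms_nonneg X
  have hel := fun x => mem_sorted_rowNorms X x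
  have hmm : ∀ p (hp : p < (mergeSort (rowNorms X).ret).ret.toArray.size),
      (mergeSort (rowNorms X).ret).ret.toArray[p].1 = ∑ k,
        X (mergeSort (rowNorms X).ret).ret.toArray[p].2 k *
        X (mergeSort (rowNorms X).ret).ret.toArray[p].2 k :=
    fun p hp => hel _ (by simp)
  generalize (mergeSort (rowNorms X).ret).ret.toArray = a at *
  have cs : ∀ p q (hp : p < a.size) (hq : q < a.size),
      (∑ k, X a[p].2 k * X a[q].2 k) ^ 2 ≤ a[p].1 * a[q].1 := by
    intro p q hp hq
    rw [hmm p hp, hmm q hq]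
    simpa only [sq] using
      Finset.sum_mul_sq_le_sq_mul_sq Finset.univ (fun k => X a[p].2 k) (fun k => X a[q].2 k)
  rcases le_total q p with hqp | hpq
  · exact heavyLoop_complete X _ hs h0 _ _ _ _ q p (Nat.zero_le _) hqp hp
      (h.trans (cs p q hp hq)) h
  · have h' : d / κ ≤ (∑ k, X a[q].2 k * X a[p].2 k) ^ 2 := by
      simpa only [mul_comm] using h
    rw [Sym2.eq_swap]
    exact heavyLoop_complete X _ hs h0 _ _ _ _ p q (Nat.zero_le _) hpq hq
      (h'.trans (cs q p hq hp)) h'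

theorem crossLeverage_time (hτ : 0 < d / κ) {T : ℝ} (hT : ∑ i, ∑ k, X i k * X i k ≤ T) :
    ((crossLeverage d κ X).time : ℝ) ≤ (5 * r + 1) * n + 5 * n * Nat.clog 2 n + 8 * n + 4 +
      (5 * r + 6) * (T ^ 2 / (d / κ)) := by
  have hlen : (mergeSort (rowNorms X).ret).ret.length = n := by
    rw [(mergeSort_rowNorms_perm X).length_eq, List.length_ofFn]
  have hsum : ((mergeSort (rowNorms X).ret).ret.toArray.toList.map Prod.fst).sum =
      ∑ i, ∑ k, X i k * X i k := by
    rw [((mergeSort_rowNorms_perm X).map Prod.fst).sum_eq, List.map_ofFn, List.sum_ofFn]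
    rfl
  have hT0 : 0 ≤ T := le_trans (Finset.sum_nonneg fun i _ => Finset.sum_nonneg fun k _ =>
    mul_self_nonneg _) hT
  have h1 := heavyLoop_time X (d / κ) (mergeSort_sorted (rowNorms X).ret)
    (sorted_rowNorms_nonneg X) hτ (hsum.le.trans hT) hT0
    (mergeSort (rowNorms X).ret).ret.toArray.size le_rfl 0 []
  have h2 : ((mergeSort (rowNorms X).ret).time : ℝ) ≤ 5 * n * Nat.clog 2 n + 1 := by
    have := mergeSort_time (rowNorms X).ret
    rw [← (mergeSort_perm (rowNorms X).ret).length_eq, hlen] at this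
    exact_mod_cast this
  have h3 : ((rowNorms X).time : ℝ) = (5 * r + 1) * n := by
    rw [rowNorms_eq]; push_cast; rfl
  have h4 : (crossLeverage d κ X).time = 1 + ((rowNorms X).time +
    ((mergeSort (rowNorms X).ret).time + (((mergeSort (rowNorms X).ret).ret.length + 1) +
      (heavyLoop X (d / κ) (mergeSort (rowNorms X).ret).ret.toArray
      (mergeSort (rowNorms X).ret).ret.toArray.size le_rfl 0 []).time))) := rfl
  rw [h4, hlen]
  have h5 : (List.map Prod.fst (List.take (mergeSort (rowNorms X).ret).ret.toArray.size
      (mergeSort (rowNorms X).ret).ret.toArray.toList)).sum ≤ T := by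
    rw [List.take_of_length_le (by simp), hsum]
    exact hT
  have h6 : (5 * r + 6) * (T / (d / κ)) * (List.map Prod.fst (List.take
      (mergeSort (rowNorms X).ret).ret.toArray.size
      (mergeSort (rowNorms X).ret).ret.toArray.toList)).sum ≤
      (5 * r + 6) * (T / (d / κ)) * T := mul_le_mul_of_nonneg_left h5 (by positivity)
  have h7 : ((mergeSort (rowNorms X).ret).ret.toArray.size - 0 : ℕ) = n := by simpa using hlen
  rw [h7] at h1
  have h8 : (5 * r + 6) * (T / (d / κ)) * T = (5 * r + 6) * (T ^ 2 / (d / κ)) := by ring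
  push_cast
  linarith

end Algorithm

/-! ### Traces of powers of symmetric matrices -/

theorem exists_orthogonal_diagonalization {κ : Type*} [Fintype κ] [DecidableEq κ]
    {A : Matrix κ κ ℝ} (hA : A.IsSymm) :
    ∃ (V : Matrix κ κ ℝ) (a : κ → ℝ), V.transpose * V = 1 ∧ V * V.transpose = 1 ∧
      A = V * Matrix.diagonal a * V.transpose := by
  have hH : A.IsHermitian := by
    rw [Matrix.IsHermitian, Matrix.conjTranspose_eq_transpose_of_trivial]; exact hA
  have h1 := hH.eigenvectorUnitary.2
  rw [Matrix.mem_unitaryGroup_iff, Matrix.star_eq_conjTranspose,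
    Matrix.conjTranspose_eq_transpose_of_trivial] at h1
  refine ⟨hH.eigenvectorUnitary, hH.eigenvalues, mul_eq_one_comm.1 h1, h1, ?_⟩
  have h2 := hH.spectral_theorem
  rw [Unitary.conjStarAlgAut_apply, Matrix.star_eq_conjTranspose,
    Matrix.conjTranspose_eq_transpose_of_trivial] at h2
  exact h2

section SampleSum

variable {κ ι : Type*} {r : ℕ}

/-- The sum of the matrices `Y i` over a sample `s` of indices. -/
def sampleSum (Y : ι → Matrix κ κ ℝ) (s : Fin r → ι) : Matrix κ κ ℝ := ∑ t, Y (s t)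

variable {Y : ι → Matrix κ κ ℝ}

theorem sampleSum_isSymm (hY : ∀ i, (Y i).IsSymm) (s : Fin r → ι) : (sampleSum Y s).IsSymm := by
  rw [Matrix.IsSymm, sampleSum, Matrix.transpose_sum]
  exact Finset.sum_congr rfl fun t _ => hY _

theorem sampleSum_sub_update (s : Fin r → ι) (t : Fin r) (i : ι) :
    sampleSum Y s - sampleSum Y (Function.update s t i) = Y (s t) - Y i := by
  rw [sampleSum, sampleSum, ← Finset.sum_sub_distrib, Finset.sum_eq_single t]
  · simp
  · intro u _ hu
    simp [Function.update_of_ne hu]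
  · simp

end SampleSum

section Spectral

variable {κ : Type*} [Fintype κ] [DecidableEq κ]

theorem conj_diagonal_pow {V : Matrix κ κ ℝ} (h : V.transpose * V = 1)
    (h' : V * V.transpose = 1) (a : κ → ℝ) (j : ℕ) :
    (V * Matrix.diagonal a * V.transpose) ^ j =
      V * Matrix.diagonal (fun k => a k ^ j) * V.transpose := by
  induction j with
  | zero => simp [h']
  | succ j ih =>
    rw [pow_succ, ih]
    calc _ = V * Matrix.diagonal (fun k => a k ^ j) * (V.transpose * V) *
          Matrix.diagonal a * V.transpose := by simp only [Matrix.mul_assoc]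
      _ = _ := by
        rw [h, Matrix.mul_one, Matrix.mul_assoc V, Matrix.diagonal_mul_diagonal]
        simp only [pow_succ]

/-- The joint spectral weights of two symmetric matrices: `w k l` is the squared inner product
of the `k`-th eigenvector of `A` with the `l`-th eigenvector of `B`. -/
theorem exists_joint_weights {A B : Matrix κ κ ℝ} (hA : A.IsSymm) (hB : B.IsSymm) :
    ∃ (a b : κ → ℝ) (w : κ → κ → ℝ), (∀ k l, 0 ≤ w k l) ∧
      ∀ i j : ℕ, (A ^ i * B ^ j).trace = ∑ k, ∑ l, a k ^ i * b l ^ j * w k l := by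
  obtain ⟨V, a, hV, hV', rfl⟩ := exists_orthogonal_diagonalization hA
  obtain ⟨W, b, hW, hW', rfl⟩ := exists_orthogonal_diagonalization hB
  refine ⟨a, b, fun k l => (V.transpose * W) k l ^ 2, fun k l => sq_nonneg _, fun i j => ?_⟩
  rw [conj_diagonal_pow hV hV', conj_diagonal_pow hW hW']
  have : (V * Matrix.diagonal (fun k => a k ^ i) * V.transpose *
      (W * Matrix.diagonal (fun k => b k ^ j) * W.transpose)).trace =
      ((Matrix.diagonal (fun k => a k ^ i) * (V.transpose * W)) *
        (Matrix.diagonal (fun k => b k ^ j) * (V.transpose * W).transpose)).trace := by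
    rw [Matrix.transpose_mul, Matrix.transpose_transpose]
    rw [Matrix.mul_assoc V, Matrix.mul_assoc V, Matrix.trace_mul_comm V]
    simp only [Matrix.mul_assoc]
  rw [this, Matrix.trace]
  refine Finset.sum_congr rfl fun k _ => ?_
  rw [Matrix.diag_apply, Matrix.mul_apply]
  refine Finset.sum_congr rfl fun l _ => ?_
  rw [Matrix.diagonal_mul, Matrix.diagonal_mul, Matrix.transpose_apply]
  ring

/-- A mean value inequality: `(a - b) (a ^ q - b ^ q) ≤ q (a - b) ² (a ^ (q-1) + b ^ (q-1))` for
odd `q = 2 m + 1`. -/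
theorem sub_mul_pow_sub_pow_le (a b : ℝ) (m : ℕ) :
    (a - b) * (a ^ (2 * m + 1) - b ^ (2 * m + 1)) ≤
      (2 * m + 1) * ((a - b) ^ 2 * (a ^ (2 * m) + b ^ (2 * m))) := by
  rw [← geom_sum₂_mul a b (2 * m + 1)]
  have h : ∑ i ∈ Finset.range (2 * m + 1), a ^ i * b ^ (2 * m + 1 - 1 - i) ≤
      (2 * m + 1) * (a ^ (2 * m) + b ^ (2 * m)) := by
    have h1 : ∀ i ∈ Finset.range (2 * m + 1),
        a ^ i * b ^ (2 * m + 1 - 1 - i) ≤ a ^ (2 * m) + b ^ (2 * m) := by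
      intro i hi
      have hi' : i + (2 * m + 1 - 1 - i) = 2 * m := by
        have := Finset.mem_range.1 hi; omega
      generalize 2 * m + 1 - 1 - i = j at hi'
      have ha : |a| ^ (2 * m) = a ^ (2 * m) := by rw [pow_mul, sq_abs, ← pow_mul]
      have hb : |b| ^ (2 * m) = b ^ (2 * m) := by rw [pow_mul, sq_abs, ← pow_mul]
      calc a ^ i * b ^ j ≤ |a ^ i * b ^ j| := le_abs_self _
        _ = |a| ^ i * |b| ^ j := by rw [abs_mul, abs_pow, abs_pow]
        _ ≤ max |a| |b| ^ i * max |a| |b| ^ j := by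
          gcongr
          · exact le_max_left _ _
          · exact le_max_right _ _
        _ = max |a| |b| ^ (2 * m) := by rw [← pow_add, hi']
        _ ≤ a ^ (2 * m) + b ^ (2 * m) := by
          rw [← ha, ← hb]
          rcases max_choice |a| |b| with h | h <;> rw [h]
          · exact le_add_of_nonneg_right (by positivity)
          · exact le_add_of_nonneg_left (by positivity)
    refine (Finset.sum_le_sum h1).trans ?_
    simp only [Finset.sum_const, Finset.card_range, nsmul_eq_mul]
    push_cast
    exact le_rfl
  nlinarith [mul_le_mul_of_nonneg_left h (sq_nonneg (a - b))]

/-- The trace form of the mean value inequality for odd powers of symmetric matrices. -/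
theorem trace_sub_mul_pow_sub_pow_le {A B : Matrix κ κ ℝ} (hA : A.IsSymm) (hB : B.IsSymm)
    (m : ℕ) :
    ((A - B) * (A ^ (2 * m + 1) - B ^ (2 * m + 1))).trace ≤
      (2 * m + 1) * (((A - B) ^ 2 * A ^ (2 * m)).trace + ((A - B) ^ 2 * B ^ (2 * m)).trace) := by
  obtain ⟨a, b, w, hw, h⟩ := exists_joint_weights hA hB
  have e1 : ((A - B) * (A ^ (2 * m + 1) - B ^ (2 * m + 1))).trace =
      ∑ k, ∑ l, (a k - b l) * (a k ^ (2 * m + 1) - b l ^ (2 * m + 1)) * w k l := by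
    have : ((A - B) * (A ^ (2 * m + 1) - B ^ (2 * m + 1))).trace =
        (A ^ (2 * m + 2) * B ^ 0).trace - (A ^ 1 * B ^ (2 * m + 1)).trace -
        (A ^ (2 * m + 1) * B ^ 1).trace + (A ^ 0 * B ^ (2 * m + 2)).trace := by
      rw [Matrix.trace_mul_comm (A ^ (2 * m + 1)) (B ^ 1), ← Matrix.trace_sub,
        ← Matrix.trace_sub, ← Matrix.trace_add]
      congr 1
      rw [pow_succ' A (2 * m + 1), pow_succ' B (2 * m + 1), pow_succ' A (2 * m), pow_succ' B (2 * m)]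
      noncomm_ring
    rw [this, h, h, h, h]
    simp only [← Finset.sum_sub_distrib, ← Finset.sum_add_distrib]
    refine Finset.sum_congr rfl fun k _ => Finset.sum_congr rfl fun l _ => by ring
  have e2 : ((A - B) ^ 2 * A ^ (2 * m)).trace =
      ∑ k, ∑ l, (a k - b l) ^ 2 * a k ^ (2 * m) * w k l := by
    have : ((A - B) ^ 2 * A ^ (2 * m)).trace =
        (A ^ (2 * m + 2) * B ^ 0).trace - (A ^ (2 * m + 1) * B ^ 1).trace -
        (A ^ (2 * m + 1) * B ^ 1).trace + (A ^ (2 * m) * B ^ 2).trace := by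
      have h3 : (A ^ (2 * m + 1) * B ^ 1).trace = (A * B * A ^ (2 * m)).trace := by
        rw [pow_succ, pow_one, Matrix.mul_assoc, Matrix.trace_mul_comm]
      have h4 : (A ^ (2 * m + 1) * B ^ 1).trace = (B * A * A ^ (2 * m)).trace := by
        rw [pow_succ', pow_one, Matrix.trace_mul_comm, Matrix.mul_assoc]
      rw [Matrix.trace_mul_comm (A ^ (2 * m)) (B ^ 2)]
      nth_rewrite 1 [h3]
      rw [h4, ← Matrix.trace_sub, ← Matrix.trace_sub, ← Matrix.trace_add]
      congr 1
      rw [show 2 * m + 2 = (2 * m + 1) + 1 from rfl, pow_succ' A, pow_succ' A]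
      noncomm_ring
    rw [this, h, h, h]
    simp only [← Finset.sum_sub_distrib, ← Finset.sum_add_distrib]
    refine Finset.sum_congr rfl fun k _ => Finset.sum_congr rfl fun l _ => by ring
  have e3 : ((A - B) ^ 2 * B ^ (2 * m)).trace =
      ∑ k, ∑ l, (a k - b l) ^ 2 * b l ^ (2 * m) * w k l := by
    have : ((A - B) ^ 2 * B ^ (2 * m)).trace =
        (A ^ 0 * B ^ (2 * m + 2)).trace - (A ^ 1 * B ^ (2 * m + 1)).trace -
        (A ^ 1 * B ^ (2 * m + 1)).trace + (A ^ 2 * B ^ (2 * m)).trace := by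
      have h3 : (A ^ 1 * B ^ (2 * m + 1)).trace = (A * B * B ^ (2 * m)).trace := by
        rw [pow_one, pow_succ', ← Matrix.mul_assoc]
      have h4 : (A ^ 1 * B ^ (2 * m + 1)).trace = (B * A * B ^ (2 * m)).trace := by
        rw [pow_one, pow_succ, ← Matrix.mul_assoc, Matrix.trace_mul_comm, ← Matrix.mul_assoc]
      nth_rewrite 1 [h3]
      rw [h4, ← Matrix.trace_sub, ← Matrix.trace_sub, ← Matrix.trace_add]
      congr 1
      rw [show 2 * m + 2 = (2 * m + 1) + 1 from rfl, pow_succ' B, pow_succ' B]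
      noncomm_ring
    rw [this, h, h, h]
    simp only [← Finset.sum_sub_distrib, ← Finset.sum_add_distrib]
    refine Finset.sum_congr rfl fun k _ => Finset.sum_congr rfl fun l _ => by ring
  rw [e1, e2, e3]
  simp only [← Finset.sum_add_distrib, Finset.mul_sum]
  refine Finset.sum_le_sum fun k _ => Finset.sum_le_sum fun l _ => ?_
  nlinarith [mul_le_mul_of_nonneg_right (sub_mul_pow_sub_pow_le (a k) (b l) m) (hw k l)]

theorem trace_mul_even_pow_nonneg {Q S : Matrix κ κ ℝ} (hQ : Q.PosSemidef) (hS : S.IsSymm)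
    (m : ℕ) : 0 ≤ (Q * S ^ (2 * m)).trace := by
  have h1 : (S ^ m).transpose = S ^ m := by rw [Matrix.transpose_pow, hS.eq]
  have h2 := (hQ.mul_mul_conjTranspose_same (S ^ m)).trace_nonneg
  rwa [Matrix.conjTranspose_eq_transpose_of_trivial, h1, Matrix.trace_mul_comm,
    ← Matrix.mul_assoc, ← pow_add, ← two_mul, Matrix.trace_mul_comm] at h2

/-! ### Moments of a sum of independent matrices -/

section Moments

variable {ι : Type*} [Fintype ι] {r : ℕ} {Y : ι → Matrix κ κ ℝ}

/-- Exchanging the `t`-th sample with a fresh one preserves the uniform distribution of the pair. -/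
theorem sum_resample {M : Type*} [AddCommMonoid M] (t : Fin r) (f : (Fin r → ι) → ι → M) :
    ∑ s, ∑ i, f (Function.update s t i) (s t) = ∑ s, ∑ i, f s i := by
  rw [← Fintype.sum_prod_type', ← Fintype.sum_prod_type']
  refine Finset.sum_nbij' (fun p => (Function.update p.1 t p.2, p.1 t))
    (fun p => (Function.update p.1 t p.2, p.1 t)) (by simp) (by simp) ?_ ?_ (by simp)
  · rintro ⟨s, i⟩ _; simp
  · rintro ⟨s, i⟩ _; simp

/-- The exchangeable pair argument: `s` and the sample with `s t` resampled have the same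
distribution, so the trace of `Y (s t) S ^ q` averages to half of the trace of
`(S - S') (S ^ q - S' ^ q)`. -/
theorem sum_trace_resample_le (hY : ∀ i, (Y i).IsSymm) (h0 : ∑ i, Y i = 0) (t : Fin r) (m : ℕ) :
    (Fintype.card ι : ℝ) * ∑ s : Fin r → ι, (Y (s t) * sampleSum Y s ^ (2 * m + 1)).trace ≤
      (2 * m + 1) * ∑ s : Fin r → ι, (((Fintype.card ι : ℝ) • Y (s t) ^ 2 + ∑ i, Y i ^ 2) *
        sampleSum Y s ^ (2 * m)).trace := by
  set q := 2 * m + 1 with hq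
  have e1 : ∑ s : Fin r → ι, ∑ i, ((Y (s t) - Y i) * sampleSum Y s ^ q).trace =
      (Fintype.card ι : ℝ) * ∑ s : Fin r → ι, (Y (s t) * sampleSum Y s ^ q).trace := by
    rw [Finset.mul_sum]
    refine Finset.sum_congr rfl fun s _ => ?_
    rw [← Matrix.trace_sum, ← Finset.sum_mul, Finset.sum_sub_distrib, h0, sub_zero,
      Finset.sum_const, Finset.card_univ, ← Nat.cast_smul_eq_nsmul ℝ, Matrix.smul_mul,
      Matrix.trace_smul, smul_eq_mul]
  have e2 : ∑ s : Fin r → ι, ∑ i, ((Y (s t) - Y i) ^ 2 * sampleSum Y s ^ (2 * m)).trace =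
      ∑ s : Fin r → ι, (((Fintype.card ι : ℝ) • Y (s t) ^ 2 + ∑ i, Y i ^ 2) *
        sampleSum Y s ^ (2 * m)).trace := by
    refine Finset.sum_congr rfl fun s _ => ?_
    rw [← Matrix.trace_sum, ← Finset.sum_mul]
    congr 2
    have : ∀ i, (Y (s t) - Y i) ^ 2 = Y (s t) ^ 2 - Y (s t) * Y i - Y i * Y (s t) + Y i ^ 2 :=
      fun i => by noncomm_ring
    simp only [this, Finset.sum_add_distrib, Finset.sum_sub_distrib, ← Finset.mul_sum,
      ← Finset.sum_mul, h0]
    simp [← Nat.cast_smul_eq_nsmul ℝ]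
  have e3 := sum_resample t fun (s : Fin r → ι) i => ((Y (s t) - Y i) * sampleSum Y s ^ q).trace
  have e4 := sum_resample t fun (s : Fin r → ι) i =>
    ((Y (s t) - Y i) ^ 2 * sampleSum Y s ^ (2 * m)).trace
  simp only [Function.update_self] at e3 e4
  have key : ∑ s : Fin r → ι, ∑ i, (((Y (s t) - Y i) * sampleSum Y s ^ q).trace +
      ((Y i - Y (s t)) * sampleSum Y (Function.update s t i) ^ q).trace) ≤
      ∑ s : Fin r → ι, ∑ i, (2 * m + 1) * (((Y (s t) - Y i) ^ 2 * sampleSum Y s ^ (2 * m)).trace +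
      ((Y i - Y (s t)) ^ 2 * sampleSum Y (Function.update s t i) ^ (2 * m)).trace) := by
    refine Finset.sum_le_sum fun s _ => Finset.sum_le_sum fun i _ => ?_
    have h := trace_sub_mul_pow_sub_pow_le (sampleSum_isSymm hY s)
      (sampleSum_isSymm hY (Function.update s t i)) m
    rw [sampleSum_sub_update] at h
    have h1 : (Y i - Y (s t)) ^ 2 = (Y (s t) - Y i) ^ 2 := by noncomm_ring
    rw [h1]
    refine le_of_eq_of_le ?_ h
    rw [← Matrix.trace_add, ← hq]
    congr 1
    noncomm_ring
  simp only [← Finset.mul_sum, Finset.sum_add_distrib] at key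
  rw [e3, e4, e1, e2] at key
  linarith

/-- The moment recursion for sums of independent centred matrices whose squares are controlled by
`Y ² ≤ μ Y + (μ + 1)` in the positive semidefinite order. -/
theorem sum_trace_pow_le [Nonempty ι] (hY : ∀ i, (Y i).IsSymm) (h0 : ∑ i, Y i = 0) {μ : ℝ}
    (hμ : ∀ i, (μ • Y i + (μ + 1) • (1 : Matrix κ κ ℝ) - Y i ^ 2).PosSemidef) (m : ℕ) :
    ∑ s : Fin r → ι, (sampleSum Y s ^ (2 * m + 2)).trace ≤
      (2 * m + 1) * ∑ s : Fin r → ι, (μ * (sampleSum Y s ^ (2 * m + 1)).trace +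
        2 * r * (μ + 1) * (sampleSum Y s ^ (2 * m)).trace) := by
  have hN : (0 : ℝ) < Fintype.card ι := by exact_mod_cast Fintype.card_pos
  refine le_of_mul_le_mul_left ?_ hN
  have e1 : (Fintype.card ι : ℝ) * ∑ s : Fin r → ι, (sampleSum Y s ^ (2 * m + 2)).trace =
      ∑ t, (Fintype.card ι : ℝ) *
        ∑ s : Fin r → ι, (Y (s t) * sampleSum Y s ^ (2 * m + 1)).trace := by
    rw [← Finset.mul_sum, Finset.sum_comm]
    congr 1
    refine Finset.sum_congr rfl fun s _ => ?_
    rw [← Matrix.trace_sum, ← Finset.sum_mul, pow_succ' _ (2 * m + 1)]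
    rfl
  rw [e1]
  refine (Finset.sum_le_sum fun t _ => sum_trace_resample_le hY h0 t m).trans ?_
  rw [← Finset.mul_sum, mul_left_comm]
  refine mul_le_mul_of_nonneg_left ?_ (by positivity)
  rw [Finset.sum_comm, Finset.mul_sum]
  refine Finset.sum_le_sum fun s _ => ?_
  have hS := sampleSum_isSymm (r := r) hY s
  have hb : ∀ i, (Y i ^ 2 * sampleSum Y s ^ (2 * m)).trace ≤
      μ * (Y i * sampleSum Y s ^ (2 * m)).trace + (μ + 1) * (sampleSum Y s ^ (2 * m)).trace := by
    intro i
    have h := trace_mul_even_pow_nonneg (hμ i) hS m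
    rw [Matrix.sub_mul, Matrix.add_mul, Matrix.trace_sub, Matrix.trace_add, Matrix.smul_mul,
      Matrix.smul_mul, Matrix.trace_smul, Matrix.trace_smul, Matrix.one_mul] at h
    simp only [smul_eq_mul] at h
    linarith
  have hV : ((∑ i, Y i ^ 2) * sampleSum Y s ^ (2 * m)).trace ≤
      Fintype.card ι * ((μ + 1) * (sampleSum Y s ^ (2 * m)).trace) := by
    rw [Finset.sum_mul, Matrix.trace_sum]
    refine (Finset.sum_le_sum fun i _ => hb i).trans ?_
    rw [Finset.sum_add_distrib, ← Finset.mul_sum, ← Matrix.trace_sum, ← Finset.sum_mul, h0]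
    simp
  have hT : ∑ t, (Y (s t) ^ 2 * sampleSum Y s ^ (2 * m)).trace ≤
      μ * (sampleSum Y s ^ (2 * m + 1)).trace + r * ((μ + 1) * (sampleSum Y s ^ (2 * m)).trace) := by
    refine (Finset.sum_le_sum fun t _ => hb (s t)).trans ?_
    rw [Finset.sum_add_distrib, ← Finset.mul_sum, ← Matrix.trace_sum, ← Finset.sum_mul,
      pow_succ' _ (2 * m)]
    simp [sampleSum]
  have e2 : ∀ t, (((Fintype.card ι : ℝ) • Y (s t) ^ 2 + ∑ i, Y i ^ 2) *
      sampleSum Y s ^ (2 * m)).trace = Fintype.card ι * (Y (s t) ^ 2 * sampleSum Y s ^ (2 * m)).trace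
      + ((∑ i, Y i ^ 2) * sampleSum Y s ^ (2 * m)).trace := by
    intro t
    rw [Matrix.add_mul, Matrix.trace_add, Matrix.smul_mul, Matrix.trace_smul, smul_eq_mul]
  simp only [e2]
  rw [Finset.sum_add_distrib, ← Finset.mul_sum]
  simp only [Finset.sum_const, Finset.card_univ, Fintype.card_fin, nsmul_eq_mul]
  have h5 := mul_le_mul_of_nonneg_left hT hN.le
  have h6 := mul_le_mul_of_nonneg_left hV (Nat.cast_nonneg (α := ℝ) r)
  linarith

theorem trace_pow_eq_sum {V : Matrix κ κ ℝ} (h : V.transpose * V = 1)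
    (h' : V * V.transpose = 1) (a : κ → ℝ) (j : ℕ) :
    ((V * Matrix.diagonal a * V.transpose) ^ j).trace = ∑ k, a k ^ j := by
  rw [conj_diagonal_pow h h', Matrix.mul_assoc, Matrix.trace_mul_comm, Matrix.mul_assoc, h,
    Matrix.mul_one, Matrix.trace_diagonal]

/-- Lower even moments are dominated by the top one, up to the level `lam`. -/
theorem trace_pow_interpolate {S : Matrix κ κ ℝ} (hS : S.IsSymm) {lam : ℝ} (hl : 0 < lam)
    (m : ℕ) :
    (S ^ (2 * m + 1)).trace ≤ Fintype.card κ * lam ^ (2 * m + 1) + (S ^ (2 * m + 2)).trace / lam ∧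
    (S ^ (2 * m)).trace ≤ Fintype.card κ * lam ^ (2 * m) + (S ^ (2 * m + 2)).trace / lam ^ 2 := by
  obtain ⟨V, a, hV, hV', rfl⟩ := exists_orthogonal_diagonalization hS
  simp only [trace_pow_eq_sum hV hV']
  have hc : ∀ c : ℝ, (Fintype.card κ : ℝ) * c = ∑ _k : κ, c := by simp
  have hev : ∀ x : ℝ, 0 ≤ x ^ (2 * m + 2) := fun x => by
    rw [show 2 * m + 2 = 2 * (m + 1) by ring]; exact (even_two_mul _).pow_nonneg x
  have hev' : ∀ x : ℝ, |x| ^ (2 * m + 2) = x ^ (2 * m + 2) := fun x => by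
    rw [show 2 * m + 2 = 2 * (m + 1) by ring]; exact (even_two_mul _).pow_abs x
  rw [hc, hc, Finset.sum_div, Finset.sum_div, ← Finset.sum_add_distrib, ← Finset.sum_add_distrib]
  constructor
  · refine Finset.sum_le_sum fun k _ => ?_
    rcases le_total |a k| lam with h | h
    · have h1 : a k ^ (2 * m + 1) ≤ lam ^ (2 * m + 1) :=
        (le_abs_self _).trans (by rw [abs_pow]; gcongr)
      have := div_nonneg (hev (a k)) hl.le
      linarith
    · have h1 : a k ^ (2 * m + 1) ≤ a k ^ (2 * m + 2) / lam := by
        rw [le_div_iff₀ hl]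
        calc _ ≤ |a k| ^ (2 * m + 1) * lam :=
              mul_le_mul_of_nonneg_right (by rw [← abs_pow]; exact le_abs_self _) hl.le
          _ ≤ |a k| ^ (2 * m + 1) * |a k| := by gcongr
          _ = _ := by rw [← hev' (a k), pow_succ _ (2 * m + 1)]
      have : 0 ≤ lam ^ (2 * m + 1) := by positivity
      linarith
  · refine Finset.sum_le_sum fun k _ => ?_
    rcases le_total |a k| lam with h | h
    · have h1 : a k ^ (2 * m) ≤ lam ^ (2 * m) :=
        (le_abs_self _).trans (by rw [abs_pow]; gcongr)
      have := div_nonneg (hev (a k)) (sq_nonneg lam)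
      linarith
    · have h1 : a k ^ (2 * m) ≤ a k ^ (2 * m + 2) / lam ^ 2 := by
        rw [le_div_iff₀ (by positivity)]
        calc _ ≤ |a k| ^ (2 * m) * lam ^ 2 :=
              mul_le_mul_of_nonneg_right (by rw [← abs_pow]; exact le_abs_self _) (sq_nonneg _)
          _ ≤ |a k| ^ (2 * m) * |a k| ^ 2 := by gcongr
          _ = _ := by rw [← hev' (a k), pow_add _ (2 * m)]
      have : 0 ≤ lam ^ (2 * m) := by positivity
      linarith

/-- The moment recursion closes at every level `lam` that absorbs a quarter of the top moment
in each of its two terms. -/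
theorem sum_trace_pow_le_card_mul [Nonempty ι] (hY : ∀ i, (Y i).IsSymm) (h0 : ∑ i, Y i = 0)
    {μ lam : ℝ} (hμ : ∀ i, (μ • Y i + (μ + 1) • (1 : Matrix κ κ ℝ) - Y i ^ 2).PosSemidef)
    (hμ0 : 0 ≤ μ) (hl : 0 < lam) (m : ℕ)
    (h1 : 4 * ((2 * m + 1) * μ) ≤ lam) (h2 : 8 * ((2 * m + 1) * (r * (μ + 1))) ≤ lam ^ 2) :
    ∑ s : Fin r → ι, (sampleSum Y s ^ (2 * m + 2)).trace ≤
      Fintype.card (Fin r → ι) * (Fintype.card κ * lam ^ (2 * m + 2)) := by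
  set M := ∑ s : Fin r → ι, (sampleSum Y s ^ (2 * m + 2)).trace with hM
  set D : ℝ := Fintype.card (Fin r → ι) * Fintype.card κ with hD
  have hD0 : 0 ≤ D := by positivity
  have hM0 : 0 ≤ M := Finset.sum_nonneg fun s _ => by
    have := trace_mul_even_pow_nonneg Matrix.PosSemidef.one (sampleSum_isSymm hY s) (m + 1)
    rwa [Matrix.one_mul] at this
  have ha : ∑ s : Fin r → ι, (sampleSum Y s ^ (2 * m + 1)).trace ≤
      D * lam ^ (2 * m + 1) + M / lam := by
    refine (Finset.sum_le_sum fun s _ =>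
      (trace_pow_interpolate (sampleSum_isSymm hY s) hl m).1).trans ?_
    rw [Finset.sum_add_distrib, ← Finset.sum_div, Finset.sum_const, Finset.card_univ, nsmul_eq_mul]
    rw [hD, mul_assoc]
  have hb : ∑ s : Fin r → ι, (sampleSum Y s ^ (2 * m)).trace ≤
      D * lam ^ (2 * m) + M / lam ^ 2 := by
    refine (Finset.sum_le_sum fun s _ =>
      (trace_pow_interpolate (sampleSum_isSymm hY s) hl m).2).trans ?_
    rw [Finset.sum_add_distrib, ← Finset.sum_div, Finset.sum_const, Finset.card_univ, nsmul_eq_mul]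
    rw [hD, mul_assoc]
  have hrec := sum_trace_pow_le (r := r) hY h0 hμ m
  rw [← hM, Finset.sum_add_distrib, ← Finset.mul_sum, ← Finset.mul_sum] at hrec
  have h3 : (2 * m + 1) * μ * (D * lam ^ (2 * m + 1) + M / lam) ≤
      lam / 4 * (D * lam ^ (2 * m + 1) + M / lam) :=
    mul_le_mul_of_nonneg_right (by linarith) (by positivity)
  have h4 : (2 * m + 1) * (2 * r * (μ + 1)) * (D * lam ^ (2 * m) + M / lam ^ 2) ≤
      lam ^ 2 / 4 * (D * lam ^ (2 * m) + M / lam ^ 2) :=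
    mul_le_mul_of_nonneg_right (by linarith) (by positivity)
  have h5 := mul_le_mul_of_nonneg_left ha (show 0 ≤ (2 * (m : ℝ) + 1) * μ by positivity)
  have h6 := mul_le_mul_of_nonneg_left hb
    (show 0 ≤ (2 * (m : ℝ) + 1) * (2 * r * (μ + 1)) by positivity)
  have h7 : lam / 4 * (D * lam ^ (2 * m + 1) + M / lam) =
      D * lam ^ (2 * m + 2) / 4 + M / 4 := by field_simp; ring
  have h8 : lam ^ 2 / 4 * (D * lam ^ (2 * m) + M / lam ^ 2) =
      D * lam ^ (2 * m + 2) / 4 + M / 4 := by field_simp; ring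
  rw [← mul_assoc, ← hD]
  linarith

end Moments

/-- An even trace moment bounds the operator norm. -/
theorem dotProduct_mulVec_sq_le {S : Matrix κ κ ℝ} (hS : S.IsSymm) {b : ℝ} (m : ℕ)
    (h : (S ^ (2 * m + 2)).trace ≤ b ^ (2 * m + 2)) (w : κ → ℝ) :
    S.mulVec w ⬝ᵥ S.mulVec w ≤ b ^ 2 * (w ⬝ᵥ w) := by
  obtain ⟨V, a, hV, hV', rfl⟩ := exists_orthogonal_diagonalization hS
  rw [trace_pow_eq_sum hV hV'] at h
  have hev : ∀ x : ℝ, 0 ≤ x ^ (2 * m + 2) := fun x => by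
    rw [show 2 * m + 2 = 2 * (m + 1) by ring]; exact (even_two_mul _).pow_nonneg x
  have ha : ∀ k, a k ^ 2 ≤ b ^ 2 := by
    intro k
    have h1 : a k ^ (2 * m + 2) ≤ b ^ (2 * m + 2) :=
      (Finset.single_le_sum (f := fun k => a k ^ (2 * m + 2)) (fun k _ => hev _)
        (Finset.mem_univ k)).trans h
    rw [show 2 * m + 2 = 2 * (m + 1) by ring, pow_mul, pow_mul] at h1
    exact (pow_le_pow_iff_left₀ (sq_nonneg _) (sq_nonneg _) (by omega)).1 h1
  have iso : ∀ x : κ → ℝ, V.mulVec x ⬝ᵥ V.mulVec x = x ⬝ᵥ x := by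
    intro x
    rw [Matrix.dotProduct_mulVec, Matrix.vecMul_mulVec, hV, Matrix.vecMul_one]
  have iso' : ∀ x : κ → ℝ, V.transpose.mulVec x ⬝ᵥ V.transpose.mulVec x = x ⬝ᵥ x := by
    intro x
    rw [Matrix.dotProduct_mulVec, Matrix.vecMul_mulVec, Matrix.transpose_transpose, hV',
      Matrix.vecMul_one]
  rw [← Matrix.mulVec_mulVec, ← Matrix.mulVec_mulVec, iso, ← iso' w]
  set y := V.transpose.mulVec w
  simp only [dotProduct, Matrix.mulVec_diagonal, Finset.mul_sum]
  refine Finset.sum_le_sum fun k _ => ?_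
  nlinarith [mul_le_mul_of_nonneg_right (ha k) (mul_self_nonneg (y k))]

end Spectral

/-! ### Uniform probability on finite types -/

open Classical in
/-- The probability of an event under the uniform distribution on a finite type. -/
noncomputable def prob {α : Type*} [Fintype α] (p : α → Prop) : ℝ :=
  ((Finset.univ.filter p).card : ℝ) / Fintype.card α

section Prob

variable {α : Type*} [Fintype α]

theorem prob_eq (p : α → Prop) [DecidablePred p] :
    prob p = ((Finset.univ.filter p).card : ℝ) / Fintype.card α := by
  unfold prob
  congr

theorem prob_mono {p q : α → Prop} (h : ∀ a, p a → q a) : prob p ≤ prob q := by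
  classical
  rw [prob_eq, prob_eq]
  gcongr with a
  exact h a

theorem prob_or_le (p q : α → Prop) : prob (fun a => p a ∨ q a) ≤ prob p + prob q := by
  classical
  rw [prob_eq, prob_eq, prob_eq]
  rw [← add_div]
  gcongr
  rw [Finset.filter_or]
  exact_mod_cast Finset.card_union_le _ _

theorem prob_exists_le {ι : Type*} [Fintype ι] {p : ι → α → Prop} {c : ℝ}
    (h : ∀ i, prob (p i) ≤ c) : prob (fun a => ∃ i, p i a) ≤ Fintype.card ι * c := by
  classical
  have h1 : prob (fun a => ∃ i, p i a) ≤ ∑ i, prob (p i) := by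
    simp only [prob_eq]
    rw [← Finset.sum_div]
    gcongr
    have : (Finset.univ.filter fun a => ∃ i, p i a) =
        Finset.univ.biUnion fun i => Finset.univ.filter (p i) := by
      ext a; simp
    rw [this]
    exact_mod_cast Finset.card_biUnion_le
  refine h1.trans ((Finset.sum_le_sum fun i _ => h i).trans ?_)
  simp

/-- Markov's inequality. -/
theorem prob_le_of_sum_le [Nonempty α] {p : α → Prop} {f : α → ℝ} {b c : ℝ} (hf : ∀ a, 0 ≤ f a)
    (hb : 0 < b) (hp : ∀ a, p a → b ≤ f a) (hc : ∑ a, f a ≤ Fintype.card α * c) :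
    prob p ≤ c / b := by
  classical
  unfold prob
  rw [div_le_div_iff₀ (by exact_mod_cast Fintype.card_pos) hb]
  calc ((Finset.univ.filter p).card : ℝ) * b = ∑ _a ∈ Finset.univ.filter p, b := by simp
    _ ≤ ∑ a ∈ Finset.univ.filter p, f a :=
      Finset.sum_le_sum fun a ha => hp a (Finset.mem_filter.1 ha).2
    _ ≤ ∑ a, f a := Finset.sum_le_univ_sum_of_nonneg hf
    _ ≤ _ := hc.trans (mul_comm _ _).le

theorem prob_comp_equiv {β : Type*} [Fintype β] (e : α ≃ β) (p : β → Prop) :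
    prob (fun a => p (e a)) = prob p := by
  classical
  unfold prob
  rw [Fintype.card_congr e]
  congr 2
  refine Finset.card_equiv e fun a => ?_
  simp

/-- If the second coordinate fails with probability at most `c` for each good value of the first,
then the pair fails with probability at most `c` more than the first coordinate. -/
theorem prob_prod_le {β : Type*} [Fintype β] [Nonempty α] [Nonempty β] {p : α → Prop}
    {q : α → β → Prop} {b c : ℝ} (hc0 : 0 ≤ c) (hp : prob p ≤ b)
    (hq : ∀ a, ¬ p a → prob (q a) ≤ c) :
    prob (fun x : α × β => p x.1 ∨ q x.1 x.2) ≤ b + c := by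
  classical
  have hα : (0 : ℝ) < Fintype.card α := by exact_mod_cast Fintype.card_pos
  have hβ : (0 : ℝ) < Fintype.card β := by exact_mod_cast Fintype.card_pos
  have h1 : prob (fun x : α × β => p x.1 ∨ q x.1 x.2) ≤
      prob (fun x : α × β => p x.1) + prob (fun x : α × β => ¬ p x.1 ∧ q x.1 x.2) :=
    (prob_mono fun x hx => by tauto).trans (prob_or_le _ _)
  refine h1.trans (add_le_add (le_of_eq_of_le ?_ hp) ?_)
  · unfold prob
    have : (Finset.univ.filter fun x : α × β => p x.1) =
        (Finset.univ.filter p) ×ˢ (Finset.univ : Finset β) := by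
      ext x; simp
    rw [this, Finset.card_product, Fintype.card_prod, Finset.card_univ]
    push_cast
    field_simp
  · rw [prob_eq]
    have : ((Finset.univ.filter fun x : α × β => ¬ p x.1 ∧ q x.1 x.2).card : ℝ) =
        ∑ a, ((Finset.univ.filter fun b : β => ¬ p a ∧ q a b).card : ℝ) := by
      simp only [Finset.card_filter, Nat.cast_sum, Fintype.sum_prod_type]
    rw [this, Fintype.card_prod, div_le_iff₀ (by push_cast; positivity)]
    have h2 : ∀ a, ((Finset.univ.filter fun b : β => ¬ p a ∧ q a b).card : ℝ) ≤
        c * Fintype.card β := by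
      intro a
      by_cases ha : p a
      · simpa [ha] using by positivity
      · have := hq a ha
        rw [prob_eq] at this
        rw [div_le_iff₀ hβ] at this
        simpa [ha] using this
    refine (Finset.sum_le_sum fun a _ => h2 a).trans (le_of_eq ?_)
    rw [Finset.sum_const, Finset.card_univ, nsmul_eq_mul]
    push_cast
    ring

/-- Passage from `prob` of the complement to the measure of a set. -/
theorem le_toOuterMeasure_uniformOfFintype [Nonempty α] {S : Set α} {c : ℝ}
    (h : prob (fun a => a ∉ S) ≤ 1 - c) :
    ENNReal.ofReal c ≤ (PMF.uniformOfFintype α).toOuterMeasure S := by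
  classical
  have hα : (0 : ℝ) < Fintype.card α := by exact_mod_cast Fintype.card_pos
  rw [PMF.toOuterMeasure_uniformOfFintype_apply, Fintype.card_subtype]
  rw [prob_eq] at h
  have h1 := Finset.card_filter_add_card_filter_not (s := (Finset.univ : Finset α)) (fun a => a ∈ S)
  rw [Finset.card_univ] at h1
  have h2 : ((Finset.univ.filter fun a => a ∈ S).card : ℝ) +
    (Finset.univ.filter fun a => a ∉ S).card = Fintype.card α := by exact_mod_cast h1
  have h3 : c ≤ ((Finset.univ.filter fun a => a ∈ S).card : ℝ) / Fintype.card α := by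
    rw [div_le_iff₀ hα] at h
    rw [le_div_iff₀ hα]
    linarith
  refine (ENNReal.ofReal_le_ofReal h3).trans (le_of_eq ?_)
  rw [ENNReal.ofReal_div_of_pos hα, ENNReal.ofReal_natCast, ENNReal.ofReal_natCast]

theorem sum_prod_apply {ι β : Type*} [Fintype ι] [DecidableEq ι] [Fintype β] (f : ι → β → ℝ) :
    ∑ g : ι → β, ∏ i, f i (g i) = ∏ i, ∑ b, f i b := by
  rw [Finset.prod_univ_sum, Fintype.piFinset_univ]

end Prob

/-! ### Uniform row sampling -/

section Sampling

variable {κ ι : Type*} [Fintype κ] [DecidableEq κ] [Fintype ι] [Nonempty ι]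

/-- Sampling uniformly from isotropic vectors of squared norm at most `μ`: the sample covariance of
`r ≥ 64 (2m + 1) μ / δ²` vectors is within `δ` of the identity in operator norm, except with
probability `card κ / 4 ^ (m + 1)`. -/
theorem prob_sample_covariance (x : ι → κ → ℝ)
    (hx : ∑ i, Matrix.vecMulVec (x i) (x i) = (Fintype.card ι : ℝ) • (1 : Matrix κ κ ℝ))
    {μ δ : ℝ} (hμ1 : 1 ≤ μ) (hμ : ∀ i, x i ⬝ᵥ x i ≤ μ) (hδ0 : 0 < δ) (hδ1 : δ ≤ 1) {r m : ℕ}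
    (hr : 64 * ((2 * m + 1) * μ) ≤ δ ^ 2 * r) :
    prob (fun s : Fin r → ι => ¬ ∀ w : κ → ℝ,
      (sampleSum (fun i => Matrix.vecMulVec (x i) (x i) - 1) s).mulVec w ⬝ᵥ
        (sampleSum (fun i => Matrix.vecMulVec (x i) (x i) - 1) s).mulVec w ≤
          (δ * r) ^ 2 * (w ⬝ᵥ w)) ≤ Fintype.card κ / 4 ^ (m + 1) := by
  set Y : ι → Matrix κ κ ℝ := fun i => Matrix.vecMulVec (x i) (x i) - 1 with hYdef
  have hr0 : 0 < (r : ℝ) := by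
    have h1 : 0 < 64 * ((2 * (m : ℝ) + 1) * μ) := by positivity
    exact pos_of_mul_pos_right (h1.trans_le hr) (sq_nonneg δ)
  have hY : ∀ i, (Y i).IsSymm := by
    intro i
    rw [Matrix.IsSymm, hYdef]
    simp [Matrix.transpose_vecMulVec]
  have h0 : ∑ i, Y i = 0 := by
    rw [hYdef, Finset.sum_sub_distrib, hx]
    simp [← Nat.cast_smul_eq_nsmul ℝ]
  have hpsd : ∀ i, (μ • Y i + (μ + 1) • (1 : Matrix κ κ ℝ) - Y i ^ 2).PosSemidef := by
    intro i
    have h1 : Matrix.vecMulVec (x i) (x i) * Matrix.vecMulVec (x i) (x i) =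
        (x i ⬝ᵥ x i) • Matrix.vecMulVec (x i) (x i) := by
      rw [Matrix.vecMulVec_mul_vecMulVec]
      ext a b
      simp only [Matrix.vecMulVec_apply, Matrix.smul_apply, Pi.smul_apply, smul_eq_mul]
      ring
    have h2 : μ • Y i + (μ + 1) • (1 : Matrix κ κ ℝ) - Y i ^ 2 =
        (μ + 2 - x i ⬝ᵥ x i) • Matrix.vecMulVec (x i) (x i) := by
      rw [hYdef, sq]
      simp only [sub_mul, mul_sub, h1, Matrix.one_mul, Matrix.mul_one]
      module
    rw [h2]
    refine Matrix.PosSemidef.smul ?_ (by linarith [hμ i])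
    simpa using Matrix.posSemidef_vecMulVec_self_star (x i)
  have hl : 0 < δ * r / 2 := by positivity
  have hδr : δ ^ 2 * r ≤ δ * r := by
    have : δ ^ 2 ≤ δ := by nlinarith
    gcongr
  have key := sum_trace_pow_le_card_mul (r := r) hY h0 hpsd (by linarith) hl m
    (by nlinarith) (by
      have h3 : (2 * (m : ℝ) + 1) * (r * (μ + 1)) ≤ 2 * r * ((2 * m + 1) * μ) := by
        have : (2 * (m : ℝ) + 1) * (r * (μ + 1)) ≤ (2 * (m : ℝ) + 1) * (r * (μ + μ)) := by gcongr
        linarith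
      have h4 := mul_le_mul_of_nonneg_left hr hr0.le
      nlinarith)
  have hb : 0 < (δ * r) ^ (2 * m + 2) := by positivity
  refine (prob_le_of_sum_le (fun s => ?_) hb (fun s hs => ?_) key).trans (le_of_eq ?_)
  · have := trace_mul_even_pow_nonneg Matrix.PosSemidef.one (sampleSum_isSymm hY s) (m + 1)
    rwa [Matrix.one_mul] at this
  · by_contra hlt
    exact hs (dotProduct_mulVec_sq_le (sampleSum_isSymm hY s) m (not_le.1 hlt).le)
  · rw [div_pow, show (4 : ℝ) ^ (m + 1) = 2 ^ (2 * m + 2) by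
      rw [show 2 * m + 2 = 2 * (m + 1) by ring, pow_mul]; norm_num]
    field_simp

end Sampling

/-! ### The randomized Hadamard transform -/

theorem walshHadamard_sq (m : ℕ) (i j : Fin (2 ^ m)) : walshHadamard m i j ^ 2 = 1 := by
  induction m with
  | zero => simp [walshHadamard]
  | succ m ih =>
    rw [walshHadamard]
    simp only [Matrix.submatrix_apply]
    generalize ((finCongr _).trans finSumFinEquiv.symm) i = i'
    generalize ((finCongr _).trans finSumFinEquiv.symm) j = j'
    rcases i' with i' | i' <;> rcases j' with j' | j' <;> simp [ih]

theorem walshHadamard_transpose_mul_self (m : ℕ) :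
    (walshHadamard m).transpose * walshHadamard m =
      (2 ^ m : ℝ) • (1 : Matrix (Fin (2 ^ m)) (Fin (2 ^ m)) ℝ) := by
  induction m with
  | zero =>
    ext i j
    have : i = j := Subsingleton.elim (α := Fin 1) i j
    subst this
    rw [Matrix.mul_apply]
    simp [walshHadamard]
    rfl
  | succ m ih =>
    rw [walshHadamard]
    simp only [Matrix.transpose_submatrix, Matrix.submatrix_mul_equiv]
    rw [Matrix.fromBlocks_transpose, Matrix.fromBlocks_multiply, Matrix.transpose_neg]
    simp only [Matrix.neg_mul, Matrix.mul_neg, neg_neg, ih, add_neg_cancel]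
    have : (2 ^ m : ℝ) • (1 : Matrix (Fin (2 ^ m)) (Fin (2 ^ m)) ℝ) + (2 ^ m : ℝ) • 1 =
        (2 ^ (m + 1) : ℝ) • 1 := by module
    rw [this]
    have h2 : Matrix.fromBlocks ((2 ^ (m + 1) : ℝ) • (1 : Matrix (Fin (2 ^ m)) (Fin (2 ^ m)) ℝ)) 0 0
        ((2 ^ (m + 1) : ℝ) • (1 : Matrix (Fin (2 ^ m)) (Fin (2 ^ m)) ℝ)) =
        (2 ^ (m + 1) : ℝ) • 1 := by
      rw [← Matrix.fromBlocks_one, Matrix.fromBlocks_smul]; simp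
    rw [h2, Matrix.submatrix_smul, Pi.smul_apply, Pi.smul_apply, Matrix.submatrix_one_equiv]

/-- A bound for the moment generating function of one letter carries over to linear combinations of
independent letters. -/
theorem sum_exp_linear_le {ι β : Type*} [Fintype ι] [DecidableEq ι] [Fintype β] {φ : β → ℝ} {c : ℝ}
    (hφ : ∀ s, ∑ b, Real.exp (s * φ b) ≤ Fintype.card β * Real.exp (c * s ^ 2 / 2))
    (v : ι → ℝ) (s : ℝ) :
    ∑ g : ι → β, Real.exp (s * ∑ i, v i * φ (g i)) ≤
      Fintype.card (ι → β) * Real.exp (c * s ^ 2 * (v ⬝ᵥ v) / 2) := by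
  have h1 : ∀ g : ι → β, Real.exp (s * ∑ i, v i * φ (g i)) =
      ∏ i, Real.exp (s * v i * φ (g i)) := by
    intro g
    rw [← Real.exp_sum, Finset.mul_sum]
    simp only [mul_assoc]
  simp only [h1]
  rw [sum_prod_apply fun i b => Real.exp (s * v i * φ b)]
  refine (Finset.prod_le_prod (fun i _ => Finset.sum_nonneg fun b _ => (Real.exp_pos _).le)
    fun i _ => hφ (s * v i)).trans (le_of_eq ?_)
  rw [Finset.prod_mul_distrib, ← Real.exp_sum, Fintype.card_fun]
  simp only [Finset.prod_const, Finset.card_univ, dotProduct]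
  rw [Finset.mul_sum, Finset.sum_div]
  push_cast
  congr 2
  exact Finset.sum_congr rfl fun i _ => by ring

theorem sum_exp_sign_le (s : ℝ) : ∑ u : ℤˣ, Real.exp (s * ((u : ℤ) : ℝ)) ≤
    Fintype.card ℤˣ * Real.exp (1 * s ^ 2 / 2) := by
  have h := Real.cosh_le_exp_half_sq s
  rw [Real.cosh_eq] at h
  have : (Finset.univ : Finset ℤˣ) = {1, -1} := rfl
  rw [this, Finset.sum_pair (by decide), Fintype.card_units_int]
  push_cast
  simp only [mul_one, mul_neg, one_mul]
  linarith

/-- Hoeffding's inequality for signs. -/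
theorem prob_sign_sum_ge {ι : Type*} [Fintype ι] [DecidableEq ι] (v : ι → ℝ) (hv : v ⬝ᵥ v = 1)
    {T : ℝ} (hT : 0 ≤ T) :
    prob (fun g : ι → ℤˣ => T ≤ |∑ i, v i * ((g i : ℤ) : ℝ)|) ≤ 2 * Real.exp (-(T ^ 2 / 2)) := by
  have one : ∀ a : ℝ, a ^ 2 = 1 →
      prob (fun g : ι → ℤˣ => T ≤ a * ∑ i, v i * ((g i : ℤ) : ℝ)) ≤ Real.exp (-(T ^ 2 / 2)) := by
    intro a ha
    have h := sum_exp_linear_le sum_exp_sign_le v (T * a)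
    have h2 := prob_le_of_sum_le (p := fun g : ι → ℤˣ => T ≤ a * ∑ i, v i * ((g i : ℤ) : ℝ))
      (fun g => (Real.exp_pos _).le) (Real.exp_pos (T * T)) (fun g hg => ?_) h
    · refine h2.trans (le_of_eq ?_)
      rw [← Real.exp_sub, hv, mul_pow, ha]
      congr 1
      ring
    · rw [mul_assoc]
      exact Real.exp_le_exp.2 (mul_le_mul_of_nonneg_left hg hT)
  refine (prob_mono fun g hg => ?_).trans ((prob_or_le _ _).trans
    ((add_le_add (one 1 (by norm_num)) (one (-1) (by norm_num))).trans (two_mul _).ge))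
  rcases le_abs'.1 hg with h | h
  · right; linarith
  · left; linarith

section Hadamard

variable {n d : ℕ} (U : Matrix (Fin n) (Fin d) ℝ)

/-- Row `τ` of `√N H D U`, where `H` is the normalized Hadamard matrix and `D` the diagonal matrix of
the signs `g`. With this scaling the rows are isotropic on average. -/
noncomputable def hadamardRow (g : Fin n → ℤˣ) (τ : Fin (2 ^ Nat.clog 2 n)) (k : Fin d) : ℝ :=
  ∑ i, walshHadamard (Nat.clog 2 n) τ (Fin.castLE (Nat.le_pow_clog one_lt_two n) i) * U i k *
    ((g i : ℤ) : ℝ)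

variable {U}

theorem sum_vecMulVec_hadamardRow (hU : U.transpose * U = 1) (g : Fin n → ℤˣ) :
    ∑ τ, Matrix.vecMulVec (hadamardRow U g τ) (hadamardRow U g τ) =
      (Fintype.card (Fin (2 ^ Nat.clog 2 n)) : ℝ) • (1 : Matrix (Fin d) (Fin d) ℝ) := by
  set c : Fin n → Fin (2 ^ Nat.clog 2 n) := Fin.castLE (Nat.le_pow_clog one_lt_two n) with hc
  have hinj : Function.Injective c := Fin.castLE_injective _
  have hH : ∀ i j, ∑ τ, walshHadamard (Nat.clog 2 n) τ (c i) * walshHadamard (Nat.clog 2 n) τ (c j)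
      = if i = j then (2 ^ Nat.clog 2 n : ℝ) else 0 := by
    intro i j
    have := congrFun (congrFun (walshHadamard_transpose_mul_self (Nat.clog 2 n)) (c i)) (c j)
    simpa [Matrix.mul_apply, Matrix.one_apply, hinj.eq_iff] using this
  have hg : ∀ i, ((g i : ℤ) : ℝ) * ((g i : ℤ) : ℝ) = 1 := by
    intro i
    rcases Int.units_eq_one_or (g i) with h | h <;> simp [h]
  ext k l
  have hUkl := congrFun (congrFun hU k) l
  rw [Matrix.mul_apply] at hUkl
  simp only [Matrix.transpose_apply] at hUkl
  rw [Matrix.sum_apply, Matrix.smul_apply, ← hUkl]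
  simp only [Matrix.vecMulVec_apply, hadamardRow, Finset.sum_mul_sum]
  rw [Finset.sum_comm, Finset.smul_sum]
  refine Finset.sum_congr rfl fun i _ => ?_
  rw [Finset.sum_comm, Finset.sum_eq_single i]
  · have : ∀ τ, walshHadamard (Nat.clog 2 n) τ (c i) * U i k * ((g i : ℤ) : ℝ) *
        (walshHadamard (Nat.clog 2 n) τ (c i) * U i l * ((g i : ℤ) : ℝ)) =
        walshHadamard (Nat.clog 2 n) τ (c i) * walshHadamard (Nat.clog 2 n) τ (c i) *
          (U i k * U i l) := fun τ => by
      linear_combination (walshHadamard (Nat.clog 2 n) τ (c i) *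
        walshHadamard (Nat.clog 2 n) τ (c i) * (U i k * U i l)) * hg i
    rw [Finset.sum_congr rfl fun τ _ => this τ, ← Finset.sum_mul, hH, if_pos rfl]
    simp
  · intro j _ hj
    have : ∀ τ, walshHadamard (Nat.clog 2 n) τ (c i) * U i k * ((g i : ℤ) : ℝ) *
        (walshHadamard (Nat.clog 2 n) τ (c j) * U j l * ((g j : ℤ) : ℝ)) =
        walshHadamard (Nat.clog 2 n) τ (c i) * walshHadamard (Nat.clog 2 n) τ (c j) *
          (U i k * ((g i : ℤ) : ℝ) * (U j l * ((g j : ℤ) : ℝ))) := fun τ => by ring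
    rw [Finset.sum_congr rfl fun τ _ => this τ, ← Finset.sum_mul, hH, if_neg hj.symm, zero_mul]
  · simp

/-- The random signs flatten: with high probability all rows have squared norm
at most `18 d log n`. -/
theorem prob_hadamardRow_large (hU : U.transpose * U = 1) (hd : d < n) (hn : 2 ≤ n) :
    prob (fun g : Fin n → ℤˣ => ¬ ∀ τ, hadamardRow U g τ ⬝ᵥ hadamardRow U g τ ≤
      18 * d * Real.log n) ≤ 1 / 20 := by
  have hn0 : (0 : ℝ) < n := by positivity
  have hlog : 0 ≤ Real.log n := Real.log_natCast_nonneg n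
  set T := Real.sqrt (18 * Real.log n) with hT
  have hT2 : T ^ 2 = 18 * Real.log n := Real.sq_sqrt (by positivity)
  have h1 : ∀ p : Fin (2 ^ Nat.clog 2 n) × Fin d,
      prob (fun g : Fin n → ℤˣ => T ≤ |hadamardRow U g p.1 p.2|) ≤ 2 / (n : ℝ) ^ 9 := by
    rintro ⟨τ, k⟩
    refine (prob_sign_sum_ge (fun i => walshHadamard (Nat.clog 2 n) τ
      (Fin.castLE (Nat.le_pow_clog one_lt_two n) i) * U i k) ?_ (Real.sqrt_nonneg _)).trans
      (le_of_eq ?_)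
    · have hkk := congrFun (congrFun hU k) k
      rw [Matrix.mul_apply, Matrix.one_apply_eq] at hkk
      rw [dotProduct, ← hkk]
      refine Finset.sum_congr rfl fun i _ => ?_
      have := walshHadamard_sq (Nat.clog 2 n) τ (Fin.castLE (Nat.le_pow_clog one_lt_two n) i)
      rw [Matrix.transpose_apply]
      linear_combination (U i k * U i k) * this
    · rw [← hT, hT2, show -(18 * Real.log n / 2) = -(Real.log n * (9 : ℕ)) by push_cast; ring,
        Real.exp_neg, Real.exp_mul, Real.exp_log hn0, Real.rpow_natCast, div_eq_mul_inv]
  have h2 := prob_exists_le h1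
  refine (prob_mono fun g hg => ?_).trans (h2.trans ?_)
  · by_contra hno
    push Not at hno
    refine hg fun τ => ?_
    calc hadamardRow U g τ ⬝ᵥ hadamardRow U g τ ≤ ∑ _k : Fin d, 18 * Real.log n := by
          refine Finset.sum_le_sum fun k _ => ?_
          have := hno (τ, k)
          rw [← hT2, ← sq, ← sq_abs]
          exact pow_le_pow_left₀ (abs_nonneg _) this.le 2
      _ = 18 * d * Real.log n := by simp; ring
  · rw [Fintype.card_prod, Fintype.card_fin, Fintype.card_fin]
    have hN : 2 ^ Nat.clog 2 n ≤ 2 * n := by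
      have h3 := Nat.pow_pred_clog_lt_self one_lt_two (show 1 < n by omega)
      have h4 : 0 < Nat.clog 2 n := Nat.clog_pos one_lt_two hn
      obtain ⟨m, hm⟩ : ∃ m, Nat.clog 2 n = m + 1 := ⟨_, (Nat.succ_pred_eq_of_pos h4).symm⟩
      rw [hm] at h3 ⊢
      simp only [Nat.pred_succ] at h3
      rw [pow_succ]; omega
    have h5 : ((2 ^ Nat.clog 2 n * d : ℕ) : ℝ) ≤ 2 * n ^ 2 := by
      have : 2 ^ Nat.clog 2 n * d ≤ 2 * n * n := Nat.mul_le_mul hN hd.le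
      calc ((2 ^ Nat.clog 2 n * d : ℕ) : ℝ) ≤ ((2 * n * n : ℕ) : ℝ) := by exact_mod_cast this
        _ = _ := by push_cast; ring
    have h6 : (2 : ℝ) ^ 7 ≤ (n : ℝ) ^ 7 := by
      have : (2 : ℝ) ≤ n := by exact_mod_cast hn
      gcongr
    calc _ ≤ 2 * (n : ℝ) ^ 2 * (2 / (n : ℝ) ^ 9) := by gcongr
      _ = 4 / (n : ℝ) ^ 7 := by field_simp; norm_num
      _ ≤ 1 / 20 := by
        rw [div_le_div_iff₀ (by positivity) (by norm_num)]
        linarith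

theorem srht_mul_apply {r : ℕ} (g : Fin n → ℤˣ) (s : Fin r → Fin (2 ^ Nat.clog 2 n))
    (t : Fin r) (k : Fin d) :
    (srht g s * U) t k = (Real.sqrt r)⁻¹ * hadamardRow U g (s t) k := by
  have hN : (0 : ℝ) < 2 ^ Nat.clog 2 n := by positivity
  have hs := (Real.sqrt_pos.2 hN).ne'
  rw [Matrix.mul_apply, hadamardRow, Finset.mul_sum]
  refine Finset.sum_congr rfl fun i _ => ?_
  rw [srht, Real.sqrt_div hN.le]
  field_simp

/-- The Gram matrix of the sketched basis is the sample covariance of the flattened rows. -/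
theorem gram_srht_mul {r : ℕ} (hr : 0 < r) (g : Fin n → ℤˣ)
    (s : Fin r → Fin (2 ^ Nat.clog 2 n)) :
    (srht g s * U).transpose * (srht g s * U) = 1 + (r : ℝ)⁻¹ •
      sampleSum (fun τ => Matrix.vecMulVec (hadamardRow U g τ) (hadamardRow U g τ) - 1) s := by
  have hr' : (r : ℝ) ≠ 0 := by positivity
  have h1 : (r : ℝ)⁻¹ • ∑ t, Matrix.vecMulVec (hadamardRow U g (s t)) (hadamardRow U g (s t)) =
      (srht g s * U).transpose * (srht g s * U) := by
    ext k l
    rw [Matrix.mul_apply, Matrix.smul_apply, Matrix.sum_apply, smul_eq_mul, Finset.mul_sum]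
    refine Finset.sum_congr rfl fun t _ => ?_
    rw [Matrix.transpose_apply, srht_mul_apply, srht_mul_apply, Matrix.vecMulVec_apply]
    have : (Real.sqrt r)⁻¹ * (Real.sqrt r)⁻¹ = (r : ℝ)⁻¹ := by
      rw [← mul_inv, Real.mul_self_sqrt (Nat.cast_nonneg r)]
    rw [← this]; ring
  rw [sampleSum, Finset.sum_sub_distrib, smul_sub, h1]
  simp [← Nat.cast_smul_eq_nsmul ℝ, smul_smul, hr']

end Hadamard

/-! ### The Johnson-Lindenstrauss property of sparse signs -/

/-- The values of an entry of `√r Π₂`: `√3` and `-√3` with probability `1/6` each, and `0`. -/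
noncomputable def sparseSign (b : Fin 6) : ℝ :=
  if b = 0 then Real.sqrt 3 else if b = 1 then -Real.sqrt 3 else 0

theorem sum_comp_sparseSign (F : ℝ → ℝ) :
    ∑ b, F (sparseSign b) = F (Real.sqrt 3) + F (-Real.sqrt 3) + 4 * F 0 := by
  have h : ∀ b : Fin 6, b ≠ 0 → b ≠ 1 → sparseSign b = 0 := fun b h0 h1 => by
    rw [sparseSign, if_neg h0, if_neg h1]
  have h1 : sparseSign 1 = -Real.sqrt 3 := by
    rw [sparseSign, if_neg (by decide), if_pos rfl]
  rw [Fin.sum_univ_six, h 2 (by decide) (by decide), h 3 (by decide) (by decide),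
    h 4 (by decide) (by decide), h 5 (by decide) (by decide), h1, sparseSign, if_pos rfl]
  ring

theorem sum_sparseSign : ∑ b, sparseSign b = 0 :=
  (sum_comp_sparseSign fun x => x).trans (by ring)

theorem sum_sparseSign_sq : ∑ b, sparseSign b * sparseSign b = 6 :=
  (sum_comp_sparseSign fun x => x * x).trans (by
    have := Real.mul_self_sqrt (show (0 : ℝ) ≤ 3 by norm_num)
    linear_combination 2 * this)

theorem sum_exp_sparseSign_le (s : ℝ) :
    ∑ b, Real.exp (s * sparseSign b) ≤ Fintype.card (Fin 6) * Real.exp (3 * s ^ 2 / 2) := by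
  have h := Real.cosh_le_exp_half_sq (s * Real.sqrt 3)
  rw [Real.cosh_eq, mul_pow, Real.sq_sqrt (by norm_num), mul_comm (s ^ 2)] at h
  have h1 : (1 : ℝ) ≤ Real.exp (3 * s ^ 2 / 2) := Real.one_le_exp (by positivity)
  rw [sum_comp_sparseSign fun x => Real.exp (s * x), Fintype.card_fin, mul_zero, Real.exp_zero,
    mul_neg]
  push_cast
  linarith

section Column

variable {d : ℕ} (v : Fin d → ℝ)

/-- The second moments of independent sparse signs. -/
theorem sum_sparseSign_mul (k l : Fin d) :
    ∑ g : Fin d → Fin 6, sparseSign (g k) * sparseSign (g l) =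
      if k = l then (Fintype.card (Fin d → Fin 6) : ℝ) else 0 := by
  split
  · rename_i h
    subst h
    have h1 : ∀ g : Fin d → Fin 6, sparseSign (g k) * sparseSign (g k) =
        ∏ i, if i = k then sparseSign (g i) * sparseSign (g i) else 1 := by
      intro g
      rw [Finset.prod_ite_eq' Finset.univ k]; simp
    simp only [h1]
    rw [sum_prod_apply fun i b => if i = k then sparseSign b * sparseSign b else 1]
    have h2 : ∀ i, (∑ b : Fin 6, if i = k then sparseSign b * sparseSign b else 1) = 6 := by
      intro i
      split
      · exact sum_sparseSign_sq
      · simp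
    simp [h2]
  · rename_i h
    have h1 : ∀ g : Fin d → Fin 6, sparseSign (g k) * sparseSign (g l) =
        ∏ i, (if i = k then sparseSign (g i) else 1) * if i = l then sparseSign (g i) else 1 := by
      intro g
      rw [Finset.prod_mul_distrib, Finset.prod_ite_eq' Finset.univ k,
        Finset.prod_ite_eq' Finset.univ l]
      simp
    simp only [h1]
    rw [sum_prod_apply fun i b => (if i = k then sparseSign b else 1) *
      if i = l then sparseSign b else 1]
    refine Finset.prod_eq_zero (Finset.mem_univ k) ?_
    simp [h, sum_sparseSign]

theorem sum_sq_linear_sparseSign :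
    ∑ g : Fin d → Fin 6, (∑ k, v k * sparseSign (g k)) ^ 2 =
      Fintype.card (Fin d → Fin 6) * (v ⬝ᵥ v) := by
  have h1 : ∀ g : Fin d → Fin 6, (∑ k, v k * sparseSign (g k)) ^ 2 =
      ∑ k, ∑ l, v k * v l * (sparseSign (g k) * sparseSign (g l)) := by
    intro g
    rw [sq, Finset.sum_mul_sum]
    refine Finset.sum_congr rfl fun k _ => Finset.sum_congr rfl fun l _ => by ring
  simp only [h1]
  rw [Finset.sum_comm, dotProduct, Finset.mul_sum]
  refine Finset.sum_congr rfl fun k _ => ?_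
  rw [Finset.sum_comm]
  simp only [← Finset.mul_sum, sum_sparseSign_mul]
  simp
  ring

open MeasureTheory in
/-- The square of a sub-Gaussian sum has an exponential moment. It is found by
writing `exp (z² / 12)` as the Gaussian average of `exp (z y / √6)`. -/
theorem sum_exp_sq_linear_sparseSign_le (hv : v ⬝ᵥ v = 1) :
    ∑ g : Fin d → Fin 6, Real.exp ((∑ k, v k * sparseSign (g k)) ^ 2 / 12) ≤
      Fintype.card (Fin d → Fin 6) * Real.sqrt 2 := by
  have hint : ∀ b : ℝ, 0 < b → Integrable fun y : ℝ => Real.exp (-b * y ^ 2) :=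
    fun b hb => integrable_exp_neg_mul_sq hb
  -- completing the square
  have hsq : ∀ z y : ℝ, Real.exp (z / Real.sqrt 6 * y) * Real.exp (-(1 / 2) * y ^ 2) =
      Real.exp (z ^ 2 / 12) * Real.exp (-(1 / 2) * (y - z / Real.sqrt 6) ^ 2) := by
    intro z y
    rw [← Real.exp_add, ← Real.exp_add]
    congr 1
    have : (z / Real.sqrt 6) ^ 2 = z ^ 2 / 6 := by
      rw [div_pow, Real.sq_sqrt (by norm_num)]
    linear_combination (1 / 2) * this
  have hi : ∀ z : ℝ, Integrable fun y : ℝ =>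
      Real.exp (z / Real.sqrt 6 * y) * Real.exp (-(1 / 2) * y ^ 2) := by
    intro z
    simp only [hsq]
    exact ((hint (1 / 2) (by norm_num)).comp_sub_right _).const_mul _
  have hI : ∀ z : ℝ, ∫ y : ℝ, Real.exp (z / Real.sqrt 6 * y) * Real.exp (-(1 / 2) * y ^ 2) =
      Real.exp (z ^ 2 / 12) * Real.sqrt (Real.pi / (1 / 2)) := by
    intro z
    simp only [hsq]
    rw [integral_const_mul, integral_sub_right_eq_self fun y : ℝ => Real.exp (-(1 / 2) * y ^ 2),
      integral_gaussian]
  have h0 : 0 < Real.sqrt (Real.pi / (1 / 2)) := Real.sqrt_pos.2 (by positivity)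
  refine le_of_mul_le_mul_right ?_ h0
  rw [Finset.sum_mul]
  simp only [← hI]
  rw [← integral_finsetSum _ fun g _ => hi _]
  have hbound : ∀ y : ℝ, ∑ g : Fin d → Fin 6, Real.exp ((∑ k, v k * sparseSign (g k)) /
      Real.sqrt 6 * y) * Real.exp (-(1 / 2) * y ^ 2) ≤
      Fintype.card (Fin d → Fin 6) * Real.exp (-(1 / 4) * y ^ 2) := by
    intro y
    rw [← Finset.sum_mul]
    have h1 := sum_exp_linear_le sum_exp_sparseSign_le v (y / Real.sqrt 6)
    have h2 : ∀ g : Fin d → Fin 6, (∑ k, v k * sparseSign (g k)) / Real.sqrt 6 * y =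
      y / Real.sqrt 6 * ∑ k, v k * sparseSign (g k) := fun g => by ring
    simp only [h2]
    refine (mul_le_mul_of_nonneg_right h1 (Real.exp_pos _).le).trans (le_of_eq ?_)
    rw [mul_assoc, ← Real.exp_add, hv, div_pow, Real.sq_sqrt (by norm_num)]
    congr 2
    ring
  refine (integral_mono (integrable_finsetSum _ fun g _ => hi _)
    ((hint (1 / 4) (by norm_num)).const_mul _) hbound).trans (le_of_eq ?_)
  rw [integral_const_mul, integral_gaussian, mul_assoc, ← Real.sqrt_mul (by norm_num)]
  congr 2
  ring

theorem exp_le_one_add_add_sq_mul_exp_abs (y : ℝ) :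
    Real.exp y ≤ 1 + y + y ^ 2 * Real.exp |y| := by
  have h := Complex.norm_exp_sub_sum_le_norm_mul_exp (y : ℂ) 2
  have h1 : Complex.exp y - ∑ m ∈ Finset.range 2, (y : ℂ) ^ m / (m.factorial : ℂ) =
      ((Real.exp y - (1 + y) : ℝ) : ℂ) := by
    simp [Finset.sum_range_succ]
  rw [h1, Complex.norm_real, Complex.norm_real, Real.norm_eq_abs, Real.norm_eq_abs, sq_abs] at h
  linarith [le_abs_self (Real.exp y - (1 + y))]

/-- The centred square of a sub-Gaussian sum of variance one is sub-exponential. -/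
theorem sum_exp_centred_sq_le (hv : v ⬝ᵥ v = 1) {θ : ℝ} (hθ : |θ| ≤ 1 / 24) :
    ∑ g : Fin d → Fin 6, Real.exp (θ * ((∑ k, v k * sparseSign (g k)) ^ 2 - 1)) ≤
      Fintype.card (Fin d → Fin 6) * Real.exp (2304 * θ ^ 2) := by
  have hpt : ∀ z : ℝ, Real.exp (θ * (z ^ 2 - 1)) ≤
      1 + θ * (z ^ 2 - 1) + θ ^ 2 * (1152 * (Real.exp (1 / 12) * Real.exp (z ^ 2 / 12))) := by
    intro z
    set W := z ^ 2 - 1 with hW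
    have h1 := exp_le_one_add_add_sq_mul_exp_abs (θ * W)
    have hWz : |W| ≤ 1 + z ^ 2 := by
      rw [abs_le]; constructor <;> nlinarith [sq_nonneg z]
    -- `W² ≤ 1152 exp (|W| / 24)`
    have h2 : W ^ 2 ≤ 1152 * Real.exp (|W| / 24) := by
      have := Real.quadratic_le_exp_of_nonneg (show 0 ≤ |W| / 24 by positivity)
      have h4 : (|W| / 24) ^ 2 = W ^ 2 / 576 := by rw [div_pow, sq_abs]; norm_num
      rw [h4] at this
      have : 0 ≤ |W| / 24 := by positivity
      linarith
    have h3 : Real.exp |θ * W| ≤ Real.exp (|W| / 24) := by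
      apply Real.exp_le_exp.2
      rw [abs_mul]
      nlinarith [abs_nonneg W]
    have h5 : W ^ 2 * Real.exp |θ * W| ≤ 1152 * (Real.exp (1 / 12) * Real.exp (z ^ 2 / 12)) := by
      calc W ^ 2 * Real.exp |θ * W| ≤ 1152 * Real.exp (|W| / 24) * Real.exp (|W| / 24) := by
            gcongr
        _ = 1152 * Real.exp (|W| / 12) := by
          rw [mul_assoc, ← Real.exp_add]; congr 2; ring
        _ ≤ 1152 * Real.exp (1 / 12 + z ^ 2 / 12) := by
          gcongr; linarith
        _ = _ := by rw [Real.exp_add]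
    have h6 := mul_le_mul_of_nonneg_left h5 (sq_nonneg θ)
    rw [mul_pow] at h1
    linarith
  refine (Finset.sum_le_sum fun g _ => hpt _).trans ?_
  rw [Finset.sum_add_distrib, Finset.sum_add_distrib, ← Finset.mul_sum, Finset.sum_sub_distrib,
    sum_sq_linear_sparseSign, hv]
  simp only [← Finset.mul_sum]
  have h7 := sum_exp_sq_linear_sparseSign_le v hv
  set D : ℝ := ((Fintype.card (Fin d → Fin 6) : ℕ) : ℝ) with hD
  have hD0 : 0 ≤ D := by positivity
  have h8 : Real.exp (1 / 12) * Real.sqrt 2 ≤ 2 := by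
    have ha : Real.exp (1 / 12) ≤ 4 / 3 := by
      have : Real.exp (1 / 12) ≤ Real.exp (Real.log (4 / 3)) := by
        apply Real.exp_le_exp.2
        have := Real.one_sub_inv_le_log_of_pos (show (0 : ℝ) < 4 / 3 by norm_num)
        norm_num at this ⊢
        linarith
      rwa [Real.exp_log (by norm_num)] at this
    have hb : Real.sqrt 2 ≤ 3 / 2 := by
      rw [Real.sqrt_le_left (by norm_num)]; norm_num
    calc _ ≤ (4 / 3 : ℝ) * (3 / 2) := by gcongr
      _ = 2 := by norm_num
  have h9 : Real.exp (1 / 12) * ∑ g : Fin d → Fin 6,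
      Real.exp ((∑ k, v k * sparseSign (g k)) ^ 2 / 12) ≤ 2 * D := by
    calc _ ≤ Real.exp (1 / 12) * (D * Real.sqrt 2) := by gcongr
      _ = D * (Real.exp (1 / 12) * Real.sqrt 2) := by ring
      _ ≤ D * 2 := by gcongr
      _ = 2 * D := mul_comm _ _
  have h10 : ∑ _g : Fin d → Fin 6, (1 : ℝ) = D := by simp [hD]
  rw [h10]
  have h11 := mul_le_mul_of_nonneg_left h9 (show 0 ≤ θ ^ 2 * 1152 by positivity)
  have h12 : 1 + 2304 * θ ^ 2 ≤ Real.exp (2304 * θ ^ 2) := by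
    linarith [Real.add_one_le_exp (2304 * θ ^ 2)]
  have h13 := mul_le_mul_of_nonneg_left h12 hD0
  linarith

end Column

section JL

variable {d r : ℕ}

theorem jlt_apply (dice : Fin d → Fin r → Fin 6) (k : Fin d) (l : Fin r) :
    jlt dice k l = sparseSign (dice k l) / Real.sqrt r := by
  unfold jlt sparseSign
  rw [Real.sqrt_div (by norm_num)]
  split
  · rfl
  · split
    · rw [neg_div]
    · simp

theorem vecMul_jlt_dotProduct_self (v : Fin d → ℝ) (dice : Fin d → Fin r → Fin 6) :
    Matrix.vecMul v (jlt dice) ⬝ᵥ Matrix.vecMul v (jlt dice) =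
      (∑ l, (∑ k, v k * sparseSign (dice k l)) ^ 2) / r := by
  rw [dotProduct, Finset.sum_div]
  refine Finset.sum_congr rfl fun l _ => ?_
  have : Matrix.vecMul v (jlt dice) l = (∑ k, v k * sparseSign (dice k l)) / Real.sqrt r := by
    rw [Matrix.vecMul, dotProduct, Finset.sum_div]
    refine Finset.sum_congr rfl fun k _ => ?_
    rw [jlt_apply]; ring
  rw [this, div_mul_div_comm, Real.mul_self_sqrt (Nat.cast_nonneg r), sq]

/-- The Chernoff bound for the squared norm of the projection of a unit vector. -/
theorem prob_jlt_unit (v : Fin d → ℝ) (hv : v ⬝ᵥ v = 1) (hr : 0 < r) {η : ℝ} (h0 : 0 < η)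
    (h1 : η ≤ 1) :
    prob (fun dice : Fin d → Fin r → Fin 6 =>
      η < |Matrix.vecMul v (jlt dice) ⬝ᵥ Matrix.vecMul v (jlt dice) - 1|) ≤
      2 * Real.exp (-(η ^ 2 * r / 9216)) := by
  have hr' : (0 : ℝ) < r := by exact_mod_cast hr
  have one : ∀ a : ℝ, a ^ 2 = 1 → |a| = 1 →
      prob (fun dice : Fin d → Fin r → Fin 6 =>
        η ≤ a * (Matrix.vecMul v (jlt dice) ⬝ᵥ Matrix.vecMul v (jlt dice) - 1)) ≤
      Real.exp (-(η ^ 2 * r / 9216)) := by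
    intro a ha ha'
    set θ := η / 4608 with hθ
    have hθ0 : 0 < θ := by positivity
    have hb : |a * θ| ≤ 1 / 24 := by
      rw [abs_mul, ha', one_mul, abs_of_pos hθ0, hθ]
      linarith
    rw [← prob_comp_equiv (Equiv.piComm fun (_ : Fin r) (_ : Fin d) => Fin 6)]
    have hsum : ∑ G : Fin r → Fin d → Fin 6,
        Real.exp (∑ l, a * θ * ((∑ k, v k * sparseSign (G l k)) ^ 2 - 1)) ≤
        Fintype.card (Fin r → Fin d → Fin 6) * Real.exp (2304 * θ ^ 2 * r) := by
      simp only [Real.exp_sum]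
      rw [sum_prod_apply fun (_ : Fin r) (g : Fin d → Fin 6) =>
        Real.exp (a * θ * ((∑ k, v k * sparseSign (g k)) ^ 2 - 1))]
      refine (Finset.prod_le_prod (fun i _ => Finset.sum_nonneg fun b _ => (Real.exp_pos _).le)
        fun i _ => sum_exp_centred_sq_le v hv hb).trans (le_of_eq ?_)
      rw [Finset.prod_const, Finset.card_univ, Fintype.card_fin, mul_pow, ← Real.exp_nat_mul,
        Fintype.card_fun (α := Fin r), Fintype.card_fin r, mul_pow a, ha]
      push_cast
      congr 2
      ring
    refine (prob_le_of_sum_le (fun G => (Real.exp_pos _).le) (Real.exp_pos (θ * η * r))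
      (fun G hG => ?_) hsum).trans (le_of_eq ?_)
    · apply Real.exp_le_exp.2
      rw [vecMul_jlt_dotProduct_self] at hG
      have h2 : ∑ l, a * θ * ((∑ k, v k * sparseSign (G l k)) ^ 2 - 1) =
          θ * r * (a * ((∑ l, (∑ k, v k * sparseSign (G l k)) ^ 2) / r - 1)) := by
        rw [← Finset.mul_sum, Finset.sum_sub_distrib]
        simp only [Finset.sum_const, Finset.card_univ, Fintype.card_fin, nsmul_eq_mul, mul_one]
        field_simp
      rw [h2]
      have := mul_le_mul_of_nonneg_left hG (show 0 ≤ θ * r by positivity)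
      calc θ * η * r = θ * r * η := by ring
        _ ≤ _ := this
    · rw [← Real.exp_sub, hθ]
      congr 1
      ring
  refine (prob_mono fun g hg => ?_).trans ((prob_or_le _ _).trans
    ((add_le_add (one 1 (by norm_num) (by norm_num)) (one (-1) (by norm_num) (by norm_num))).trans
      (two_mul _).ge))
  rcases lt_abs.1 hg with h | h
  · left; linarith
  · right; linarith

theorem prob_jlt (v : Fin d → ℝ) (hr : 0 < r) {η : ℝ} (h0 : 0 < η) (h1 : η ≤ 1) :
    prob (fun dice : Fin d → Fin r → Fin 6 => η * (v ⬝ᵥ v) <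
      |Matrix.vecMul v (jlt dice) ⬝ᵥ Matrix.vecMul v (jlt dice) - v ⬝ᵥ v|) ≤
      2 * Real.exp (-(η ^ 2 * r / 9216)) := by
  rcases eq_or_ne v 0 with rfl | hv
  · refine le_of_eq_of_le ?_ (show 0 ≤ 2 * Real.exp (-(η ^ 2 * r / 9216)) by positivity)
    simp [prob]
  have hpos : 0 < v ⬝ᵥ v := by
    have h2 : 0 ≤ v ⬝ᵥ v := Finset.sum_nonneg fun k _ => mul_self_nonneg _
    exact lt_of_le_of_ne h2 fun h => hv (dotProduct_self_eq_zero.1 h.symm)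
  set c := Real.sqrt (v ⬝ᵥ v) with hc
  have hc2 : c * c = v ⬝ᵥ v := Real.mul_self_sqrt hpos.le
  have hc0 : 0 < c := Real.sqrt_pos.2 hpos
  set u : Fin d → ℝ := c⁻¹ • v with hu
  have hvu : v = c • u := by rw [hu, smul_smul, mul_inv_cancel₀ hc0.ne', one_smul]
  have huu : u ⬝ᵥ u = 1 := by
    rw [hu, smul_dotProduct, dotProduct_smul, ← hc2]
    simp only [smul_eq_mul]
    field_simp
  refine (prob_mono fun dice hd => ?_).trans (prob_jlt_unit u huu hr h0 h1)
  rw [← hc2] at hd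
  have h3 : Matrix.vecMul v (jlt dice) ⬝ᵥ Matrix.vecMul v (jlt dice) - c * c =
      c * c * (Matrix.vecMul u (jlt dice) ⬝ᵥ Matrix.vecMul u (jlt dice) - 1) := by
    rw [hvu, Matrix.smul_vecMul, smul_dotProduct, dotProduct_smul]
    simp only [smul_eq_mul]
    ring
  rw [h3, abs_mul, abs_of_pos (mul_pos hc0 hc0), mul_comm η] at hd
  exact lt_of_mul_lt_mul_left hd (mul_pos hc0 hc0).le

/-- Polarization: preservation of the norms of `‖z‖ y ± ‖y‖ z` gives preservation of
the inner product of `y` and `z`. -/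
theorem abs_dotProduct_sub_le_of_norms {M : Matrix (Fin d) (Fin r) ℝ} {η : ℝ}
    (y z : Fin d → ℝ)
    (h : ∀ a : ℝ, a ^ 2 = 1 → ∀ v, v = Real.sqrt (z ⬝ᵥ z) • y + (a * Real.sqrt (y ⬝ᵥ y)) • z →
      |Matrix.vecMul v M ⬝ᵥ Matrix.vecMul v M - v ⬝ᵥ v| ≤ η * (v ⬝ᵥ v)) :
    |Matrix.vecMul y M ⬝ᵥ Matrix.vecMul z M - y ⬝ᵥ z| ≤
      η * (Real.sqrt (y ⬝ᵥ y) * Real.sqrt (z ⬝ᵥ z)) := by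
  have hyy : 0 ≤ y ⬝ᵥ y := Finset.sum_nonneg fun k _ => mul_self_nonneg _
  have hzz : 0 ≤ z ⬝ᵥ z := Finset.sum_nonneg fun k _ => mul_self_nonneg _
  set α := Real.sqrt (z ⬝ᵥ z) with hα
  set β := Real.sqrt (y ⬝ᵥ y) with hβ
  have hα2 : α * α = z ⬝ᵥ z := Real.mul_self_sqrt hzz
  have hβ2 : β * β = y ⬝ᵥ y := Real.mul_self_sqrt hyy
  rcases eq_or_ne β 0 with hb | hb
  · have : y = 0 := dotProduct_self_eq_zero.1 (by rw [← hβ2, hb, mul_zero])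
    subst this
    simp [hb]
  rcases eq_or_ne α 0 with ha | ha
  · have : z = 0 := dotProduct_self_eq_zero.1 (by rw [← hα2, ha, mul_zero])
    subst this
    simp [ha]
  have hα0 : 0 < α := lt_of_le_of_ne (Real.sqrt_nonneg _) ha.symm
  have hβ0 : 0 < β := lt_of_le_of_ne (Real.sqrt_nonneg _) hb.symm
  have expand : ∀ a : ℝ, ∀ p q : Fin r → ℝ, (α • p + (a * β) • q) ⬝ᵥ (α • p + (a * β) • q) =
      α * α * (p ⬝ᵥ p) + 2 * a * (α * β) * (p ⬝ᵥ q) + a ^ 2 * (β * β) * (q ⬝ᵥ q) := by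
    intro a p q
    simp only [add_dotProduct, dotProduct_add, smul_dotProduct, dotProduct_smul, smul_eq_mul,
      dotProduct_comm q p]
    ring
  have expand' : ∀ a : ℝ, ∀ p q : Fin d → ℝ, (α • p + (a * β) • q) ⬝ᵥ (α • p + (a * β) • q) =
      α * α * (p ⬝ᵥ p) + 2 * a * (α * β) * (p ⬝ᵥ q) + a ^ 2 * (β * β) * (q ⬝ᵥ q) := by
    intro a p q
    simp only [add_dotProduct, dotProduct_add, smul_dotProduct, dotProduct_smul, smul_eq_mul,
      dotProduct_comm q p]
    ring
  have h1 := abs_le.1 (h 1 (by norm_num) _ rfl)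
  have h2 := abs_le.1 (h (-1) (by norm_num) _ rfl)
  rw [Matrix.add_vecMul, Matrix.smul_vecMul, Matrix.smul_vecMul, expand, expand', ← hα2, ← hβ2]
    at h1 h2
  have h3 : 0 < 4 * (α * β) := by positivity
  rw [abs_le]
  constructor
  · refine le_of_mul_le_mul_left ?_ h3
    linarith [h1.1, h2.2]
  · refine le_of_mul_le_mul_left ?_ h3
    linarith [h1.2, h2.1]

/-- With high probability all inner products of `n` given vectors are preserved. -/
theorem prob_jlt_inner {n : ℕ} (hn : 2 ≤ n) (Y : Matrix (Fin n) (Fin d) ℝ) (hr : 0 < r) {η : ℝ}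
    (h0 : 0 < η) (h1 : η ≤ 1) (hr2 : 9 * Real.log n ≤ η ^ 2 * r / 9216) :
    prob (fun dice : Fin d → Fin r → Fin 6 => ¬ ∀ i j,
      |Matrix.vecMul (Y i) (jlt dice) ⬝ᵥ Matrix.vecMul (Y j) (jlt dice) - Y i ⬝ᵥ Y j| ≤
        η * (Real.sqrt (Y i ⬝ᵥ Y i) * Real.sqrt (Y j ⬝ᵥ Y j))) ≤ 1 / 20 := by
  have hn0 : (0 : ℝ) < n := by positivity
  set V : (Fin n × Fin n) × Bool → Fin d → ℝ := fun p =>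
    Real.sqrt (Y p.1.2 ⬝ᵥ Y p.1.2) • Y p.1.1 +
      ((if p.2 then (1 : ℝ) else -1) * Real.sqrt (Y p.1.1 ⬝ᵥ Y p.1.1)) • Y p.1.2 with hV
  have h2 := prob_exists_le fun p => prob_jlt (r := r) (V p) hr h0 h1
  refine (prob_mono fun dice hd => ?_).trans (h2.trans ?_)
  · by_contra hno
    push Not at hno
    refine hd fun i j => abs_dotProduct_sub_le_of_norms (Y i) (Y j) ?_
    intro a ha v hv
    rcases sq_eq_sq_iff_eq_or_eq_neg.1 (ha.trans (one_pow 2).symm) with rfl | rfl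
    · have := hno ((i, j), true)
      simp only [hV, if_true] at this
      rw [hv]
      exact this
    · have := hno ((i, j), false)
      simp only [hV, Bool.false_eq_true, if_false] at this
      rw [hv]
      exact this
  · have h3 : Real.exp (-(η ^ 2 * r / 9216)) ≤ 1 / (n : ℝ) ^ 9 := by
      calc Real.exp (-(η ^ 2 * r / 9216)) ≤ Real.exp (-(Real.log n * (9 : ℕ))) := by
            apply Real.exp_le_exp.2; push_cast; linarith
        _ = _ := by rw [Real.exp_neg, Real.exp_mul, Real.exp_log hn0, Real.rpow_natCast, one_div]
    have h6 : (2 : ℝ) ^ 7 ≤ (n : ℝ) ^ 7 := by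
      have : (2 : ℝ) ≤ n := by exact_mod_cast hn
      gcongr
    have h7 : ((Fintype.card ((Fin n × Fin n) × Bool) : ℕ) : ℝ) = 2 * (n : ℝ) ^ 2 := by
      simp; ring
    rw [h7]
    calc _ ≤ 2 * (n : ℝ) ^ 2 * (2 * (1 / (n : ℝ) ^ 9)) := by gcongr
      _ = 4 / (n : ℝ) ^ 7 := by field_simp; norm_num
      _ ≤ 1 / 20 := by
        rw [div_le_div_iff₀ (by positivity) (by norm_num)]
        linarith

end JL

/-! ### Perturbation of the cross-leverage scores -/

section Perturbation

variable {d : ℕ}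

theorem dotProduct_sq_le (u v : Fin d → ℝ) : (u ⬝ᵥ v) ^ 2 ≤ (u ⬝ᵥ u) * (v ⬝ᵥ v) := by
  simpa only [dotProduct, sq] using Finset.sum_mul_sq_le_sq_mul_sq Finset.univ u v

theorem dotProduct_self_nonneg_real (u : Fin d → ℝ) : 0 ≤ u ⬝ᵥ u :=
  Finset.sum_nonneg fun _ _ => mul_self_nonneg _

/-- If `E` has operator norm at most `δ ≤ 1/2`, then `‖w‖ ≤ 2 ‖(1 + E) w‖`. -/
theorem dotProduct_self_le_of_near_one {E : Matrix (Fin d) (Fin d) ℝ} {δ : ℝ} (h0 : 0 ≤ δ)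
    (h1 : δ ≤ 1 / 2) (hE : ∀ w, E.mulVec w ⬝ᵥ E.mulVec w ≤ δ ^ 2 * (w ⬝ᵥ w)) (w : Fin d → ℝ) :
    w ⬝ᵥ w ≤ 4 * ((1 + E).mulVec w ⬝ᵥ (1 + E).mulVec w) := by
  have h2 := hE w
  have h3 := dotProduct_self_nonneg_real w
  have h4 : δ ^ 2 ≤ 1 / 4 := by nlinarith
  rw [Matrix.add_mulVec, Matrix.one_mulVec]
  set e := E.mulVec w
  have h5 : 0 ≤ (w + (2 : ℝ) • e) ⬝ᵥ (w + (2 : ℝ) • e) := dotProduct_self_nonneg_real _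
  simp only [add_dotProduct, dotProduct_add, smul_dotProduct, dotProduct_smul, smul_eq_mul,
    dotProduct_comm e w] at h5 ⊢
  nlinarith

variable {n r : ℕ} {A U : Matrix (Fin n) (Fin d) ℝ} {σ : Fin d → ℝ} {V : Matrix (Fin d) (Fin d) ℝ}

theorem IsThinSVD.isUnit_right (h : IsThinSVD A U σ V) :
    IsUnit (Matrix.diagonal σ * V.transpose) := by
  have h1 : (Matrix.diagonal σ * V.transpose) * (V * Matrix.diagonal fun k => (σ k)⁻¹) = 1 := by
    calc _ = Matrix.diagonal σ * (V.transpose * V) * Matrix.diagonal fun k => (σ k)⁻¹ := by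
          simp only [Matrix.mul_assoc]
      _ = 1 := by
        rw [h.orthV, Matrix.mul_one, Matrix.diagonal_mul_diagonal, ← Matrix.diagonal_one]
        congr 1
        exact funext fun k => mul_inv_cancel₀ (h.pos k).ne'
  exact IsUnit.of_mul_eq_one _ h1

/-- A sketch that nearly preserves the geometry of the column space has full rank. -/
theorem rank_sketch {S : Matrix (Fin r) (Fin n) ℝ} (h : IsThinSVD A U σ V)
    {E : Matrix (Fin d) (Fin d) ℝ} {δ : ℝ} (h0 : 0 ≤ δ) (h1 : δ ≤ 1 / 2)
    (hE : ∀ w, E.mulVec w ⬝ᵥ E.mulVec w ≤ δ ^ 2 * (w ⬝ᵥ w))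
    (hG : (S * U).transpose * (S * U) = 1 + E) : (S * A).rank = d := by
  have hu : IsUnit (1 + E) := by
    rw [← Matrix.mulVec_injective_iff_isUnit]
    intro w w' hw
    have h2 : (1 + E).mulVec (w - w') = 0 := by
      rw [Matrix.mulVec_sub, sub_eq_zero]; exact hw
    have h3 := dotProduct_self_le_of_near_one h0 h1 hE (w - w')
    rw [h2, dotProduct_zero, mul_zero] at h3
    exact sub_eq_zero.1 (dotProduct_self_eq_zero.1
      (le_antisymm h3 (dotProduct_self_nonneg_real _)))
  set Q := Matrix.diagonal σ * V.transpose with hQ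
  have hQu : IsUnit Q := h.isUnit_right
  have hB : (S * A).transpose * (S * A) = Q.transpose * (1 + E) * Q := by
    rw [← hG, h.eq, Matrix.mul_assoc U, ← hQ, ← Matrix.mul_assoc S, Matrix.transpose_mul]
    simp only [Matrix.mul_assoc]
  rw [← Matrix.rank_transpose_mul_self, hB, Matrix.rank_of_isUnit, Fintype.card_fin]
  exact (((Matrix.isUnit_transpose Q).2 hQu).mul hu).mul hQu

/-- After orthogonalization by means of the sketch, inner products of rows of `A R⁻¹` are close to
the cross-leverage scores: `A R⁻¹ = U M` with `M Mᵀ = (1 + E)⁻¹`. -/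
theorem abs_dotProduct_rows_sub_le {S : Matrix (Fin r) (Fin n) ℝ} (h : IsThinSVD A U σ V)
    {E : Matrix (Fin d) (Fin d) ℝ} {δ : ℝ} (h0 : 0 ≤ δ) (h1 : δ ≤ 1 / 2)
    (hE : ∀ w, E.mulVec w ⬝ᵥ E.mulVec w ≤ δ ^ 2 * (w ⬝ᵥ w))
    (hG : (S * U).transpose * (S * U) = 1 + E)
    {T : Matrix (Fin d) (Fin d) ℝ} (hT : IsOrthogonalizer (S * A) T) (i j : Fin n) :
    |(A * T) i ⬝ᵥ (A * T) j - U i ⬝ᵥ U j| ≤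
      2 * δ * (Real.sqrt (U i ⬝ᵥ U i) * Real.sqrt (U j ⬝ᵥ U j)) := by
  set M := Matrix.diagonal σ * V.transpose * T with hM
  have hAT : A * T = U * M := by
    rw [h.eq, hM]; simp only [Matrix.mul_assoc]
  have hMG : M.transpose * (1 + E) * M = 1 := by
    rw [← hG, ← hT, Matrix.mul_assoc S A T, hAT, ← Matrix.mul_assoc S U M,
      Matrix.transpose_mul (S * U) M]
    simp only [Matrix.mul_assoc]
  have hGP : (1 + E) * (M * M.transpose) = 1 := by
    have h2 : M * (M.transpose * (1 + E)) = 1 := mul_eq_one_comm.1 hMG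
    rw [← Matrix.mul_assoc] at h2
    exact mul_eq_one_comm.1 h2
  -- `U_i · w` is the inner product of rows `i` and `j` of `A T`, and `U_j = w + E w`
  set w := (M * M.transpose).mulVec (U j) with hw
  have hrows : (A * T) i ⬝ᵥ (A * T) j = U i ⬝ᵥ w := by
    rw [hAT, Matrix.mul_apply_eq_vecMul, Matrix.mul_apply_eq_vecMul, hw, ← Matrix.mulVec_mulVec,
      Matrix.mulVec_transpose, Matrix.dotProduct_mulVec]
  have hGw : (1 + E).mulVec w = U j := by
    rw [hw, Matrix.mulVec_mulVec, hGP, Matrix.one_mulVec]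
  have hdiff : (A * T) i ⬝ᵥ (A * T) j - U i ⬝ᵥ U j = -(U i ⬝ᵥ E.mulVec w) := by
    rw [hrows]
    conv_lhs => rw [← hGw]
    rw [Matrix.add_mulVec, Matrix.one_mulVec, dotProduct_add]
    ring
  rw [hdiff, abs_neg]
  have h3 := dotProduct_self_le_of_near_one h0 h1 hE w
  rw [hGw] at h3
  have h4 := dotProduct_sq_le (U i) (E.mulVec w)
  have hi := dotProduct_self_nonneg_real (U i)
  have hj := dotProduct_self_nonneg_real (U j)
  refine abs_le_of_sq_le_sq ?_ (by positivity)
  calc (U i ⬝ᵥ E.mulVec w) ^ 2 ≤ (U i ⬝ᵥ U i) * (δ ^ 2 * (4 * (U j ⬝ᵥ U j))) := by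
        refine h4.trans (mul_le_mul_of_nonneg_left ((hE w).trans ?_) hi)
        gcongr
    _ = _ := by
      rw [mul_pow, mul_pow (Real.sqrt _), Real.sq_sqrt hi, Real.sq_sqrt hj]
      ring

end Perturbation

/-! ### Error and running time for a good sketch -/

section Scores

variable {n d : ℕ} {U : Matrix (Fin n) (Fin d) ℝ}

theorem levScore_eq (U : Matrix (Fin n) (Fin d) ℝ) (i : Fin n) : levScore U i = U i ⬝ᵥ U i := by
  simp only [levScore, dotProduct, sq]

theorem sum_levScore (hU : U.transpose * U = 1) : ∑ i, levScore U i = d := by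
  have h : (U.transpose * U).trace = d := by rw [hU, Matrix.trace_one, Fintype.card_fin]
  rw [← h, Matrix.trace]
  simp only [levScore, Matrix.diag_apply, Matrix.mul_apply, Matrix.transpose_apply, ← sq]
  exact Finset.sum_comm

variable {r : ℕ} {Y : Matrix (Fin n) (Fin d) ℝ} {J : Matrix (Fin d) (Fin r) ℝ} {ε : ℝ}

/-- The two approximation steps combined. -/
theorem abs_estimate_sub_crossScore_le (h0 : 0 < ε) (h1 : ε ≤ 1 / 2)
    (hY : ∀ i j, |Y i ⬝ᵥ Y j - U i ⬝ᵥ U j| ≤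
      2 * (ε / 2) * (Real.sqrt (U i ⬝ᵥ U i) * Real.sqrt (U j ⬝ᵥ U j)))
    (hJ : ∀ i j, |Matrix.vecMul (Y i) J ⬝ᵥ Matrix.vecMul (Y j) J - Y i ⬝ᵥ Y j| ≤
      ε / 2 * (Real.sqrt (Y i ⬝ᵥ Y i) * Real.sqrt (Y j ⬝ᵥ Y j))) (i j : Fin n) :
    |∑ k, (Y * J) i k * (Y * J) j k - crossScore U i j| ≤
      7 / 4 * ε * (Real.sqrt (levScore U i) * Real.sqrt (levScore U j)) := by
  have hdiag : ∀ i, Real.sqrt (Y i ⬝ᵥ Y i) ≤ Real.sqrt (3 / 2) * Real.sqrt (U i ⬝ᵥ U i) := by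
    intro i
    rw [← Real.sqrt_mul (by norm_num)]
    apply Real.sqrt_le_sqrt
    have h2 := (abs_le.1 (hY i i)).2
    have h3 := dotProduct_self_nonneg_real (U i)
    rw [Real.mul_self_sqrt h3] at h2
    nlinarith
  have h4 : Real.sqrt (Y i ⬝ᵥ Y i) * Real.sqrt (Y j ⬝ᵥ Y j) ≤
      3 / 2 * (Real.sqrt (U i ⬝ᵥ U i) * Real.sqrt (U j ⬝ᵥ U j)) := by
    calc _ ≤ (Real.sqrt (3 / 2) * Real.sqrt (U i ⬝ᵥ U i)) *
        (Real.sqrt (3 / 2) * Real.sqrt (U j ⬝ᵥ U j)) :=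
          mul_le_mul (hdiag i) (hdiag j) (Real.sqrt_nonneg _) (by positivity)
      _ = (Real.sqrt (3 / 2) * Real.sqrt (3 / 2)) *
          (Real.sqrt (U i ⬝ᵥ U i) * Real.sqrt (U j ⬝ᵥ U j)) := by ring
      _ = _ := by rw [Real.mul_self_sqrt (by norm_num)]
  have h5 := mul_le_mul_of_nonneg_left h4 (show 0 ≤ ε / 2 by positivity)
  rw [levScore_eq, levScore_eq]
  have h6 : ∑ k, (Y * J) i k * (Y * J) j k =
      Matrix.vecMul (Y i) J ⬝ᵥ Matrix.vecMul (Y j) J := rfl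
  have h7 : crossScore U i j = U i ⬝ᵥ U j := rfl
  rw [h6, h7]
  have h8 := abs_sub_le (Matrix.vecMul (Y i) J ⬝ᵥ Matrix.vecMul (Y j) J) (Y i ⬝ᵥ Y j) (U i ⬝ᵥ U j)
  linarith [hJ i j, hY i j]

theorem abs_sq_sub_sq_le {L c c' : ℝ} (h0 : 0 < ε) (h1 : ε ≤ 1 / 2) (hL : 0 ≤ L)
    (hc : |c| ≤ L) (h : |c' - c| ≤ 7 / 4 * ε * L) : |c' ^ 2 - c ^ 2| ≤ 12 * ε * L ^ 2 := by
  have h2 : c' ^ 2 - c ^ 2 = (c' - c) * ((c' - c) + 2 * c) := by ring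
  have h3 : |(c' - c) + 2 * c| ≤ 3 * L := by
    refine (abs_add_le _ _).trans ?_
    rw [abs_mul, abs_two]
    nlinarith
  rw [h2, abs_mul]
  calc _ ≤ 7 / 4 * ε * L * (3 * L) := mul_le_mul h h3 (abs_nonneg _) (by positivity)
    _ ≤ _ := by nlinarith [mul_nonneg h0.le (sq_nonneg L)]

theorem abs_crossScore_le (i j : Fin n) :
    |crossScore U i j| ≤ Real.sqrt (levScore U i) * Real.sqrt (levScore U j) := by
  rw [levScore_eq, levScore_eq]
  have h := dotProduct_sq_le (U i) (U j)
  refine abs_le_of_sq_le_sq ?_ (by positivity)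
  rw [mul_pow, Real.sq_sqrt (dotProduct_self_nonneg_real _),
    Real.sq_sqrt (dotProduct_self_nonneg_real _)]
  exact h

theorem levScore_nonneg (i : Fin n) : 0 ≤ levScore U i :=
  Finset.sum_nonneg fun _ _ => sq_nonneg _

theorem abs_estimate_sq_sub_le {X : Matrix (Fin n) (Fin r) ℝ} (h0 : 0 < ε) (h1 : ε ≤ 1 / 2)
    (hX : ∀ i j, |∑ k, X i k * X j k - crossScore U i j| ≤
      7 / 4 * ε * (Real.sqrt (levScore U i) * Real.sqrt (levScore U j))) (i j : Fin n) :
    |(∑ k, X i k * X j k) ^ 2 - crossScore U i j ^ 2| ≤ 12 * ε * levScore U i * levScore U j := by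
  have h := abs_sq_sub_sq_le h0 h1 (by positivity) (abs_crossScore_le i j) (hX i j)
  rwa [mul_pow, Real.sq_sqrt (levScore_nonneg i), Real.sq_sqrt (levScore_nonneg j),
    ← mul_assoc] at h

theorem clog_le_log {m : ℕ} (hm : 1 ≤ m) : (Nat.clog 2 m : ℝ) ≤ 3 / 2 * Real.log m + 1 := by
  rcases Nat.lt_or_ge m 2 with h | h
  · have : m = 1 := by omega
    subst this
    simp
  have h1 := Nat.pow_pred_clog_lt_self one_lt_two (show 1 < m by omega)
  have h2 : 0 < Nat.clog 2 m := Nat.clog_pos one_lt_two h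
  obtain ⟨q, hq⟩ : ∃ q, Nat.clog 2 m = q + 1 := ⟨_, (Nat.succ_pred_eq_of_pos h2).symm⟩
  rw [hq] at h1 ⊢
  simp only [Nat.pred_succ] at h1
  have h3 : (2 : ℝ) ^ q ≤ m := by exact_mod_cast h1.le
  have h4 := Real.log_le_log (by positivity) h3
  rw [Real.log_pow] at h4
  have h5 := Real.log_two_gt_d9
  have h6 : (q : ℝ) * (2 / 3) ≤ q * Real.log 2 := by gcongr; linarith
  push_cast
  linarith

theorem log_two_le_log {n : ℕ} (hn : 2 ≤ n) : (0.69 : ℝ) ≤ Real.log n := by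
  have h : Real.log 2 ≤ Real.log n :=
    Real.log_le_log (by norm_num) (by exact_mod_cast hn)
  have := Real.log_two_gt_d9
  norm_num at this ⊢
  linarith

/-- The logarithm in the lower bound for `r₁` is at least `1`. -/
theorem exp_one_le_log_div_sq {n : ℕ} (hn : 2 ≤ n) {ε : ℝ} (h0 : 0 < ε) (h1 : ε ≤ 1 / 2) :
    Real.exp 1 ≤ Real.log n / ε ^ 2 := by
  have h : Real.log 2 ≤ Real.log n :=
    Real.log_le_log (by norm_num) (by exact_mod_cast hn)
  have h2 := Real.log_two_gt_d9
  have h3 := Real.exp_one_lt_d9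
  have h4 : ε ^ 2 ≤ 1 / 4 := by nlinarith
  rw [le_div_iff₀ (by positivity)]
  calc Real.exp 1 * ε ^ 2 ≤ Real.exp 1 * (1 / 4) := by gcongr
    _ ≤ _ := by linarith

/-- The running time bound, from a bound on the total of the squared row norms. -/
theorem crossLeverage_time_le {X : Matrix (Fin n) (Fin r) ℝ} {κ C₃ : ℝ} (hn : 2 ≤ n) (hd : 0 < d)
    (h0 : 0 < ε) (h1 : ε ≤ 1 / 2) (hκ : 1 < κ) (hr : r ≤ C₃ * (Real.log n / ε ^ 2))
    (hX : ∑ i, ∑ k, X i k * X i k ≤ 2 * d) :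
    ((crossLeverage d κ X).time : ℝ) ≤ (20 * |C₃| + 24) *
      (n * Real.log n / ε ^ 2 + κ * d * Real.log n ^ 2 / ε ^ 3) := by
  have hd' : (0 : ℝ) < d := by exact_mod_cast hd
  have hn' : (2 : ℝ) ≤ n := by exact_mod_cast hn
  have hτ : 0 < (d : ℝ) / κ := by positivity
  refine (crossLeverage_time X d κ hτ hX).trans ?_
  have hT : (2 * d : ℝ) ^ 2 / (d / κ) = 4 * (d * κ) := by field_simp; norm_num
  rw [hT]
  set L := Real.log n / ε ^ 2 with hL
  have hlog := log_two_le_log hn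
  have hL1 : 1 ≤ L := by
    have h2 := exp_one_le_log_div_sq hn h0 h1
    have h3 := Real.add_one_le_exp 1
    linarith
  have hε : ε ^ 2 ≤ 1 / 4 := by nlinarith
  have hLlog : 4 * Real.log n ≤ L := by
    rw [hL, le_div_iff₀ (by positivity)]
    nlinarith
  have hclog : (Nat.clog 2 n : ℝ) ≤ L := by
    have := clog_le_log (show 1 ≤ n by omega)
    norm_num at hlog
    linarith
  have hrC : (r : ℝ) ≤ |C₃| * L := hr.trans (by gcongr; exact le_abs_self _)
  have hC := abs_nonneg C₃
  have e1 : n * Real.log n / ε ^ 2 = n * L := by rw [hL]; ring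
  have e2 : L * (d * κ) ≤ κ * d * Real.log n ^ 2 / ε ^ 3 := by
    have : κ * d * Real.log n ^ 2 / ε ^ 3 = L * (d * κ) * (Real.log n / ε) := by
      rw [hL]; field_simp
    rw [this]
    refine le_mul_of_one_le_right (by positivity) ?_
    rw [le_div_iff₀ h0]
    norm_num at hlog
    linarith
  rw [e1]
  have hnL : (n : ℝ) ≤ n * L := le_mul_of_one_le_right (by positivity) hL1
  have hdL : d * κ ≤ L * (d * κ) := le_mul_of_one_le_left (by positivity) hL1
  have t1 : (r : ℝ) * n ≤ |C₃| * (n * L) := by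
    calc (r : ℝ) * n ≤ |C₃| * L * n := by gcongr
      _ = _ := by ring
  have t2 : (n : ℝ) * Nat.clog 2 n ≤ n * L := by gcongr
  have t3 : (r : ℝ) * (d * κ) ≤ |C₃| * (L * (d * κ)) := by
    calc (r : ℝ) * (d * κ) ≤ |C₃| * L * (d * κ) := by gcongr
      _ = _ := by ring
  have t4 := mul_le_mul_of_nonneg_left e2 (show 0 ≤ 20 * |C₃| + 24 by positivity)
  have t5 : 0 ≤ |C₃| * (n * L) := by positivity
  have t6 : 0 ≤ n * L := by positivity
  nlinarith

end Scores

/-! ### The success probability -/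

section Success

variable {n d : ℕ} {U : Matrix (Fin n) (Fin d) ℝ} {ε : ℝ}

/-- With the prescribed number of rows, the sampled transform is a subspace embedding once the
signs have flattened the rows. -/
theorem prob_embedding {g : Fin n → ℤˣ} {r : ℕ} (hU : U.transpose * U = 1) (hd : 0 < d)
    (hn : 2 ≤ n) (h0 : 0 < ε) (h1 : ε ≤ 1 / 2)
    (hflat : ∀ τ, hadamardRow U g τ ⬝ᵥ hadamardRow U g τ ≤ 18 * d * Real.log n)
    (hr : 32256 * (d * Real.log n / ε ^ 2 * Real.log (d * Real.log n / ε ^ 2)) ≤ r) :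
    prob (fun s : Fin r → Fin (2 ^ Nat.clog 2 n) => ¬ ∀ w : Fin d → ℝ,
      (sampleSum (fun τ => Matrix.vecMulVec (hadamardRow U g τ) (hadamardRow U g τ) - 1)
        s).mulVec w ⬝ᵥ
      (sampleSum (fun τ => Matrix.vecMulVec (hadamardRow U g τ) (hadamardRow U g τ) - 1)
        s).mulVec w ≤ (ε / 2 * r) ^ 2 * (w ⬝ᵥ w)) ≤ 1 / 20 := by
  have hd' : (1 : ℝ) ≤ d := by exact_mod_cast hd
  have hlog := log_two_le_log hn
  norm_num at hlog
  have hL := exp_one_le_log_div_sq hn h0 h1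
  set L := Real.log n / ε ^ 2 with hLdef
  have hX : d * Real.log n / ε ^ 2 = d * L := by rw [hLdef]; ring
  rw [hX] at hr
  have hL0 : 0 < L := (Real.exp_pos 1).trans_le hL
  have hlogX : Real.log d + 1 ≤ Real.log (d * L) := by
    rw [Real.log_mul (by positivity) hL0.ne']
    have := Real.log_le_log (Real.exp_pos 1) hL
    rw [Real.log_exp] at this
    linarith
  have hlogd : 0 ≤ Real.log d := Real.log_nonneg hd'
  have hclog := clog_le_log hd
  -- the moment order `2 m + 2` with `m + 1 = ⌈log₂ d⌉ + 3` makes `d / 4 ^ (m + 1)` at most `1 / 64`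
  have hcov := prob_sample_covariance (hadamardRow U g) (sum_vecMulVec_hadamardRow hU g)
    (μ := 18 * d * Real.log n) (δ := ε / 2) (r := r) (m := Nat.clog 2 d + 2)
    (by nlinarith) hflat (by positivity) (by linarith) (by
      have h2 : 2 * ((Nat.clog 2 d + 2 : ℕ) : ℝ) + 1 ≤ 7 * Real.log (d * L) := by
        push_cast
        linarith
      have hlogn : Real.log n = L * ε ^ 2 := by rw [hLdef]; field_simp
      calc 64 * ((2 * ((Nat.clog 2 d + 2 : ℕ) : ℝ) + 1) * (18 * d * Real.log n)) ≤
          64 * (7 * Real.log (d * L) * (18 * d * Real.log n)) := by gcongr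
        _ = ε ^ 2 / 4 * (32256 * (d * L * Real.log (d * L))) := by rw [hlogn]; ring
        _ ≤ ε ^ 2 / 4 * r := by gcongr
        _ = _ := by ring)
  refine hcov.trans ?_
  rw [Fintype.card_fin, div_le_div_iff₀ (by positivity) (by norm_num)]
  have h3 : (d : ℝ) ≤ 2 ^ Nat.clog 2 d := by exact_mod_cast Nat.le_pow_clog one_lt_two d
  have h4 : (2 : ℝ) ^ Nat.clog 2 d ≤ 4 ^ Nat.clog 2 d := by gcongr; norm_num
  have h5 : (4 : ℝ) ^ (Nat.clog 2 d + 2 + 1) = 4 ^ Nat.clog 2 d * 64 := by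
    rw [add_assoc, pow_add]; norm_num
  rw [h5]
  linarith

end Success

/-- All inner products of rows of `Ω` are within `(7/4) ε √(ℓ_i ℓ_j)` of the cross-leverage scores,
except with probability `3/20`: each of the three sources of randomness fails with probability at
most `1/20`, given that the preceding ones succeed. -/
theorem sketch_failure {n d : ℕ} (hd : 0 < d) (hdn : d < n)
    {A U : Matrix (Fin n) (Fin d) ℝ} {σ : Fin d → ℝ} {V : Matrix (Fin d) (Fin d) ℝ}
    (hA : IsThinSVD A U σ V) {ε : ℝ} (h0 : 0 < ε) (h1 : ε ≤ 1 / 2) {r₁ r₂ : ℕ}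
    (hr₁ : 32256 * (d * Real.log n / ε ^ 2 * Real.log (d * Real.log n / ε ^ 2)) ≤ r₁)
    (hr₂ : 331776 * (Real.log n / ε ^ 2) ≤ r₂)
    (Rinv : Matrix (Fin r₁) (Fin d) ℝ → Matrix (Fin d) (Fin d) ℝ)
    (hR : ∀ B : Matrix (Fin r₁) (Fin d) ℝ, B.rank = d → IsOrthogonalizer B (Rinv B)) :
    prob (fun ω : Seed n d r₁ r₂ => ¬ ∀ i j,
      |∑ k, sketch A Rinv ω i k * sketch A Rinv ω j k - crossScore U i j| ≤
        7 / 4 * ε * (Real.sqrt (levScore U i) * Real.sqrt (levScore U j))) ≤ 3 / 20 := by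
  have hn : 2 ≤ n := by omega
  have hL := exp_one_le_log_div_sq hn h0 h1
  have hL0 : 0 < Real.log n / ε ^ 2 := (Real.exp_pos 1).trans_le hL
  have hd' : (1 : ℝ) ≤ d := by exact_mod_cast hd
  have hr₂0 : 0 < r₂ := by
    have : (0 : ℝ) < r₂ := lt_of_lt_of_le (by positivity) hr₂
    exact_mod_cast this
  have hr₁0 : 0 < r₁ := by
    have h2 : 1 < d * Real.log n / ε ^ 2 := by
      have := Real.add_one_le_exp 1
      rw [mul_div_assoc]
      nlinarith
    have h3 := Real.log_pos h2
    have : (0 : ℝ) < r₁ := lt_of_lt_of_le (by positivity) hr₁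
    exact_mod_cast this
  have hJL := fun Y : Matrix (Fin n) (Fin d) ℝ => prob_jlt_inner hn Y hr₂0 (η := ε / 2)
    (by positivity) (by linarith) (by
      rw [mul_div_assoc', div_le_iff₀ (by positivity)] at hr₂
      linarith)
  have hprob := prob_prod_le (by norm_num) (prob_hadamardRow_large hA.orthU hdn hn)
    fun g hg => prob_prod_le (by norm_num)
      (prob_embedding (g := g) hA.orthU hd hn h0 h1 (not_not.1 hg) hr₁)
      fun s _ => hJL (A * Rinv (srht g s * A))
  refine (prob_mono ?_).trans (hprob.trans (by norm_num))
  rintro ⟨g, s, dice⟩ hbad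
  by_contra hgood
  push Not at hgood
  obtain ⟨-, hemb, hjl⟩ := hgood
  refine hbad ?_
  have hG := gram_srht_mul (U := U) hr₁0 g s
  set S := sampleSum (fun τ => Matrix.vecMulVec (hadamardRow U g τ) (hadamardRow U g τ) - 1) s
  have hr' : (0 : ℝ) < r₁ := by exact_mod_cast hr₁0
  have hE : ∀ w, ((r₁ : ℝ)⁻¹ • S).mulVec w ⬝ᵥ ((r₁ : ℝ)⁻¹ • S).mulVec w ≤
      (ε / 2) ^ 2 * (w ⬝ᵥ w) := by
    intro w
    rw [Matrix.smul_mulVec, smul_dotProduct, dotProduct_smul, smul_eq_mul, smul_eq_mul,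
      ← mul_assoc, ← mul_inv, inv_mul_le_iff₀ (by positivity)]
    refine (hemb w).trans (le_of_eq ?_)
    ring
  have hrank := rank_sketch hA (by positivity) (by linarith) hE hG
  exact abs_estimate_sub_crossScore_le h0 h1
    (abs_dotProduct_rows_sub_le hA (by positivity) (by linarith) hE hG (hR _ hrank)) hjl

end CrossLev

theorem theorem2 :
    ∃ C₁ > (0 : ℝ), ∃ C₂ > (0 : ℝ), ∀ C₃ : ℝ, ∃ C > (0 : ℝ),
      ∀ (n d : ℕ), 0 < d → d < n →
      ∀ A : Matrix (Fin n) (Fin d) ℝ, A.rank = d →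
      ∀ (U : Matrix (Fin n) (Fin d) ℝ) (σ : Fin d → ℝ) (V : Matrix (Fin d) (Fin d) ℝ),
        IsThinSVD A U σ V →
      ∀ ε κ : ℝ, 0 < ε → ε ≤ 1 / 2 → 1 < κ →
      ∀ r₁ r₂ : ℕ,
        C₁ * (d * Real.log n / ε ^ 2 * Real.log (d * Real.log n / ε ^ 2)) ≤ r₁ →
        C₂ * (Real.log n / ε ^ 2) ≤ r₂ →
        r₂ ≤ C₃ * (Real.log n / ε ^ 2) →
      ∀ Rinv : Matrix (Fin r₁) (Fin d) ℝ → Matrix (Fin d) (Fin d) ℝ,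
        (∀ B : Matrix (Fin r₁) (Fin d) ℝ, B.rank = d → IsOrthogonalizer B (Rinv B)) →
      (4 / 5 : ℝ≥0∞) ≤ (PMF.uniformOfFintype (Seed n d r₁ r₂)).toOuterMeasure
        {ω | (∀ i j : Fin n,
                d / κ + 12 * ε * levScore U i * levScore U j ≤ crossScore U i j ^ 2 →
                ∃ c, (s(i, j), c) ∈ (crossLeverage d κ (sketch A Rinv ω)).ret) ∧
             (∀ (i j : Fin n) (c : ℝ), (s(i, j), c) ∈ (crossLeverage d κ (sketch A Rinv ω)).ret →
                d / κ - 30 * ε * levScore U i * levScore U j ≤ crossScore U i j ^ 2 ∧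
                c ^ 2 - 30 * ε * levScore U i * levScore U j ≤ crossScore U i j ^ 2 ∧
                crossScore U i j ^ 2 ≤ c ^ 2 + 12 * ε * levScore U i * levScore U j) ∧
             ((crossLeverage d κ (sketch A Rinv ω)).time : ℝ) ≤
                C * (n * Real.log n / ε ^ 2 + κ * d * Real.log n ^ 2 / ε ^ 3)} := by
  refine ⟨32256, by norm_num, 331776, by norm_num, fun C₃ => ⟨20 * |C₃| + 24, by positivity, ?_⟩⟩
  intro n d hd hdn A _ U σ V hA ε κ h0 h1 hκ r₁ r₂ hr₁ hr₂ hr₂' Rinv hR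
  have hn : 2 ≤ n := by omega
  have h45 : (4 / 5 : ℝ≥0∞) = ENNReal.ofReal (4 / 5) := by
    rw [ENNReal.ofReal_div_of_pos (by norm_num)]
    norm_num
  rw [h45]
  refine le_toOuterMeasure_uniformOfFintype ((prob_mono fun ω hω => ?_).trans
    ((sketch_failure hd hdn hA h0 h1 hr₁ hr₂ Rinv hR).trans (by norm_num)))
  refine fun hgood => hω ?_
  have hsq := abs_estimate_sq_sub_le h0 h1 hgood
  refine ⟨fun i j hij => ?_, fun i j c hc => ?_, ?_⟩
  · apply crossLeverage_complete
    linarith [(abs_le.1 (hsq i j)).1]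
  · obtain ⟨rfl, hτ⟩ := crossLeverage_sound _ _ _ hc
    have h2 := abs_le.1 (hsq i j)
    have h3 : 0 ≤ ε * levScore U i * levScore U j :=
      mul_nonneg (mul_nonneg h0.le (levScore_nonneg i)) (levScore_nonneg j)
    refine ⟨?_, ?_, ?_⟩ <;> linarith [h2.1, h2.2]
  · refine crossLeverage_time_le hn hd h0 h1 hκ hr₂' ?_
    calc ∑ i, ∑ k, sketch A Rinv ω i k * sketch A Rinv ω i k ≤ ∑ i, 2 * levScore U i := by
          refine Finset.sum_le_sum fun i _ => ?_
          have h2 := (abs_le.1 (hgood i i)).2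
          have h3 : crossScore U i i = levScore U i := (levScore_eq U i).symm
          have h4 := levScore_nonneg (U := U) i
          rw [Real.mul_self_sqrt h4, h3] at h2
          nlinarith
      _ = 2 * d := by rw [← Finset.mul_sum, sum_levScore hA.orthU]
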